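/- **Definitions.** A $[p,n,k]$ complex orthogonal design (COD) is a $p\times n$ matrix $O$ whose nonzero entries belong to $\{\pm z_j,\pm z_j^* : 1\le j\le k\}$, where $z_1,\dots,z_k$ are complex variables, and which satisfies $O^HO=(|z_1|^2+\cdots+|z_k|^2)I_n$ identically. It is *of first type* if it has no $2\times2$ submatrix which, up to the order of its two rows and of its two columns, equals $\begin{pmatrix}\pm z_j&0\\0&\pm z_j^*\end{pmatrix}$ for some $j$ (the two signs being independent). It is *atomic* if no nonempty proper subset of its rows forms a COD (in a subset of the variables, possibly empty). Two CODs are *equivalent* if one is obtained from the other by permuting rows, permuting columns, renaming variables injectively, conjugating all instances of a variable, negating all instances of a variable, and multiplying rows or columns by $-1$. For $N\ge 1$ let $e_i$ be the $i$-th unit vector of $\mathbb F_2^{N}$, let $e=(1,\dots,1)$, let $\mathrm{wt}(\alpha)$ be the number of ones of $\alpha\in\mathbb F_2^N$, and let $\mathrm{wt}_{i,N}(\alpha)$ be the number of ones among the bits $\alpha(i),\dots,\alpha(N)$. Define a $2^{n+1}\times n$ matrix $\mathcal G_n$, with rows indexed by $\alpha\in\mathbb F_2^{n+1}$, columns by $1\le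 i\le n$ and variables by vectors of $\mathbb F_2^{n+1}$, by $\mathcal G_n(\alpha,i)=0$ if $\alpha(i)=0$; $\mathcal G_n(\alpha,i)=(-1)^{\theta(\alpha,i)}z_{\varphi(\alpha,i)}$ if $\alpha(i)=1,\ \alpha(n+1)=0$; and $\mathcal G_n(\alpha,i)=(-1)^{\theta(\alpha,i)}z^*_{\varphi(\alpha,i)}$ if $\alpha(i)=1,\ \alpha(n+1)=1$. Here $\varphi(\alpha,i)=\alpha\oplus\alpha(n+1)e\oplus e_i$, and $\theta(\alpha,i)=\mathrm{wt}_{i,n+1}(\alpha)+\frac i2$ for even $i$, $\theta(\alpha,i)=\mathrm{wt}_{i,n+1}(\alpha)+\frac{i-1}2+\alpha(n+1)$ for odd $i$. For $n=2m$, $m\ge1$, let $\mathcal G^m_{2m}$ consist of the rows $\alpha$ of $\mathcal G_{2m}$ with $\alpha(n+1)=0,\ \mathrm{wt}(\alpha)=m+1$ or with $\alpha(n+1)=1,\ \mathrm{wt}(\alpha)=m+2$. For $n=2m$ with $m\ge 2$ even, let $\mathcal H_n=(\mathcal G_{n-1},\mathcal L_n)$ be the $2^n\times n$ matrix whose last column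 has $\mathcal L_n(\alpha)=0$ if $\alpha(n)=0$ and $\mathcal L_n(\alpha)=(-1)^{\sum_{i=1}^m\alpha(2i)}z_{\alpha\oplus e_n}$ if $\alpha(n)=1$ ($\alpha\in\mathbb F_2^n$), and let $\mathcal H^m_{2m}$ consist of the rows $\alpha$ of $\mathcal H_{2m}$ with $\mathrm{wt}(\alpha)=m+1$. **Theorem.** Let $n=2m$ and let $O$ be an atomic first type $[p,n,k]$ COD with some row containing exactly $m+1$ nonzero entries. Then $$[p,n,k]=\Big[\tbinom{n}{m-1},\,n,\,\tbinom{n-1}{m-1}\Big]\quad\text{or}\quad [p,n,k]=\Big[2\tbinom{n}{m-1},\,n,\,2\tbinom{n-1}{m-1}\Big].$$ If $[p,n,k]=[2\binom{n}{m-1},n,2\binom{n-1}{m-1}]$, then $O$ is equivalent to $\mathcal G^m_{2m}$. If $[p,n,k]=[\binom{n}{m-1},n,\binom{n-1}{m-1}]$, then $m$ is even and $O$ is equivalent to $\mathcal H^m_{2m}$. -/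

import Mathlib

namespace COD

/-- An entry of a design in the variables `z v`, `v : V`: either `0`, or `s * z v`
(when `c = false`), or `s * conj (z v)` (when `c = true`), where the sign `s` is `1` or `-1`. -/
inductive Entry (V : Type) : Type
  | zero : Entry V
  | lit (s : ℤˣ) (c : Bool) (v : V) : Entry V

/-- The value of an entry once complex values are given to the variables. -/
noncomputable def Entry.eval {V : Type} (z : V → ℂ) : Entry V → ℂ
  | .zero => 0
  | .lit s c v => ((s : ℤ) : ℂ) * (if c then star (z v) else z v)

/-- The variables that occur in `A`. -/
def vars {R C V : Type} (A : Matrix R C (Entry V)) : Set V :=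
  {v | ∃ r i s c, A r i = Entry.lit s c v}

/-- `A` is a complex orthogonal design in the variables `z v`, `v ∈ W`: its nonzero entries are
`± z v` or `± conj (z v)` with `v ∈ W`, and `Aᴴ A = (∑ v ∈ W, |z v|²) I` identically
in the complex variables. -/
def IsCODOn {R C V : Type} [Fintype R] [DecidableEq C]
    (A : Matrix R C (Entry V)) (W : Finset V) : Prop :=
  vars A ⊆ (W : Set V) ∧
    ∀ z : V → ℂ, (A.map (Entry.eval z)).conjTranspose * A.map (Entry.eval z) =
      (((∑ v ∈ W, ‖z v‖ ^ 2 : ℝ) : ℂ)) • (1 : Matrix C C ℂ)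

/-- A `[p, n, k]` complex orthogonal design. -/
def IsCOD {p n k : ℕ} (A : Matrix (Fin p) (Fin n) (Entry (Fin k))) : Prop :=
  IsCODOn A Finset.univ

/-- First type: no `2 × 2` submatrix which, up to the order of its rows and columns, is
diagonal with diagonal entries `± z v` and `± conj (z v)`. -/
def IsFirstType {R C V : Type} (A : Matrix R C (Entry V)) : Prop :=
  ¬ ∃ (r r' : R) (i i' : C) (s s' : ℤˣ) (v : V),
      A r i = Entry.lit s false v ∧ A r i' = Entry.zero ∧
      A r' i = Entry.zero ∧ A r' i' = Entry.lit s' true v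

/-- Atomic: no nonempty proper set of rows forms a complex orthogonal design (in some of
the variables). -/
def IsAtomic {R C V : Type} [Fintype R] [DecidableEq C] (A : Matrix R C (Entry V)) : Prop :=
  ∀ S : Finset R, S.Nonempty → S ≠ Finset.univ →
    ¬ ∃ W : Finset V, IsCODOn (A.submatrix (fun r : {r // r ∈ S} => (r : R)) id) W

/-- Rename (`τ`), negate (where `ε v = -1`) and conjugate (where `κ v = true`) all instances of
variables, and multiply by the sign `s`. -/
def Entry.transform {V V' : Type} (s : ℤˣ) (τ : V → V') (ε : V → ℤˣ) (κ : V → Bool) :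
    Entry V → Entry V'
  | .zero => .zero
  | .lit t c v => .lit (s * ε v * t) (xor (κ v) c) (τ v)

/-- `B` is obtained from `A` by equivalence operations: a row permutation `ρ`, a column
permutation `σ`, a renaming `τ` of the occurring variables, negation (`ε`) and conjugation (`κ`)
of all instances of certain variables, negation of certain rows (`μ`) and of certain
columns (`ν`). -/
def Equivalent {R C V R' C' V' : Type} (A : Matrix R C (Entry V))
    (B : Matrix R' C' (Entry V')) : Prop :=
  ∃ (ρ : R ≃ R') (σ : C ≃ C') (τ : V → V') (ε : V → ℤˣ) (κ : V → Bool)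
    (μ : R → ℤˣ) (ν : C → ℤˣ), Set.InjOn τ (vars A) ∧
      ∀ r i, B (ρ r) (σ i) = (A r i).transform (μ r * ν i) τ ε κ

/-- The space `𝔽₂^N`. The `j`-th bit of a vector, `1 ≤ j ≤ N`, is its value at the element
`j - 1` of `Fin N`. -/
abbrev Vec (N : ℕ) : Type := Fin N → ZMod 2

/-- Number of ones. -/
def wt {N : ℕ} (α : Vec N) : ℕ := ∑ t, (α t).val

/-- Number of ones at the positions from `j` to the last one. -/
def wtFrom {N : ℕ} (j : Fin N) (α : Vec N) : ℕ :=
  ∑ t ∈ Finset.univ.filter (fun t => j ≤ t), (α t).val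

/-- The exponent `θ(α, i)` of the sign; the column `i : Fin n` is column number `i + 1`. -/
def theta {n : ℕ} (α : Vec (n + 1)) (i : Fin n) : ℕ :=
  if Even ((i : ℕ) + 1) then wtFrom i.castSucc α + ((i : ℕ) + 1) / 2
  else wtFrom i.castSucc α + (i : ℕ) / 2 + (α (Fin.last n)).val

/-- The index `φ(α, i) = α ⊕ α(n+1) e ⊕ e_i` of the variable. -/
def phi {n : ℕ} (α : Vec (n + 1)) (i : Fin n) : Vec (n + 1) :=
  α + α (Fin.last n) • (1 : Vec (n + 1)) + Pi.single i.castSucc 1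

/-- The `2^(n+1) × n` matrix `𝒢_n`. -/
def bigG (n : ℕ) : Matrix (Vec (n + 1)) (Fin n) (Entry (Vec (n + 1))) :=
  Matrix.of fun α i =>
    if α i.castSucc = 0 then Entry.zero
    else Entry.lit ((-1) ^ theta α i) (decide (α (Fin.last n) = 1)) (phi α i)

/-- The matrix `𝒢_n^w`: the rows of `𝒢_n` of weight `w + 1` with last bit `0` and those of
weight `n - w + 2` with last bit `1`. -/
def subG (n w : ℕ) : Matrix
    {α : Vec (n + 1) // (α (Fin.last n) = 0 ∧ wt α = w + 1) ∨
      (α (Fin.last n) = 1 ∧ wt α + w = n + 2)}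
    (Fin n) (Entry (Vec (n + 1))) :=
  (bigG n).submatrix Subtype.val id

/-- `ψ(α)`: the number of ones at the bits of even number. -/
def psi {N : ℕ} (α : Vec N) : ℕ :=
  ∑ t ∈ Finset.univ.filter (fun t : Fin N => Even ((t : ℕ) + 1)), (α t).val

/-- The column `ℒ_N`, `N = l + 1`. -/
def colL (l : ℕ) (α : Vec (l + 1)) : Entry (Vec (l + 1)) :=
  if α (Fin.last l) = 0 then Entry.zero
  else Entry.lit ((-1) ^ psi α) false (α + Pi.single (Fin.last l) 1)

/-- The `2^N × N` matrix `ℋ_N = (𝒢_{N-1}, ℒ_N)`, `N = l + 1`. -/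
def bigH (l : ℕ) : Matrix (Vec (l + 1)) (Fin (l + 1)) (Entry (Vec (l + 1))) :=
  Matrix.of fun α => Fin.snoc (α := fun _ => Entry (Vec (l + 1))) (bigG l α) (colL l α)

/-- The matrix `ℋ^m_{2m}`, `m ≥ 1`: the rows of `ℋ_{2m}` of weight `m + 1`. Here `2m` is
written `(2m - 1) + 1`. -/
def subH (m : ℕ) : Matrix {α : Vec (2 * m - 1 + 1) // wt α = m + 1}
    (Fin (2 * m - 1 + 1)) (Entry (Vec (2 * m - 1 + 1))) :=
  (bigH (2 * m - 1)).submatrix Subtype.val id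

end COD

/-! Setting most variables to zero in the identity `OᴴO = (∑|z|²) I` shows that each variable occurs
exactly once in each column. It also shows that two nonzero entries of a row lie in a `2 × 2`
Alamouti block: a second row carries the same two variables with columns swapped, conjugations
reversed and sign product `-1`. First type then says that the nonzero columns of the row holding `v`
in column `i` are `i` and the columns where `v` is conjugated oppositely.

Hence following the variable in column `i` of a row with support `P` to a column `j ∉ P` leads to a
row with support `P \ {i} ∪ {j}`. These moves form a covering of the Johnson graph. Over triangles
they commute (`row_row_in`), and still do so with signs attached, once the entries are weighted by
incidence signs: the Alamouti `-1` is the `-1` of `posSign_square`. Since triangles generate all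
closed walks of the Johnson graph, the covering has a section through any point (`exists_section`).

From a row of weight `m + 1` this yields a `Sheet`: rows `F P` for `(m + 1)`-sets, variables `v U`
for `m`-sets and, by Alamouti blocks, rows `F' T` with support `Tᶜ` for `(m - 1)`-sets, with all
signs explicit up to row and variable factors. The sheet is closed under sharing variables, so
atomicity makes it the whole design (`forall_row`, `forall_var`). As `n = 2m`, both `F P` and `F'
Pᶜ` have support `P`; they coincide for every `P` or for none (`F_eq_F'_compl`). If never, the
design has twice as many rows and its normal form is `𝒢`. If always, comparing the two sign formulas
on the same row forces `m` even (`even`), and the normal form is `ℋ`. Double counting nonzero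
entries gives `k`. -/

namespace COD

/-! ### Entrywise consequences of the orthogonality identity. -/

section Extraction

open scoped ComplexConjugate

variable {R C V : Type}

/-- The entry `e` is, up to sign and conjugation, the variable `z v`. -/
def Entry.Has (e : Entry V) (v : V) : Prop := ∃ s c, e = Entry.lit s c v

theorem IsCODOn.sum_eq [Fintype R] [DecidableEq C] {A : Matrix R C (Entry V)} {W : Finset V} (h : IsCODOn A W)
    (z : V → ℂ) (i j : C) :
    ∑ r, conj ((A r i).eval z) * (A r j).eval z =
      if i = j then ((∑ v ∈ W, ‖z v‖ ^ 2 : ℝ) : ℂ) else 0 := by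
  have := congrFun (congrFun (h.2 z) i) j
  simpa [Matrix.mul_apply, Matrix.one_apply] using this

theorem Entry.eval_eq_zero {e : Entry V} {z : V → ℂ} (h : ∀ v, e.Has v → z v = 0) :
    e.eval z = 0 := by
  cases e with
  | zero => rfl
  | lit s c v => cases c <;> simp [Entry.eval, h v ⟨s, _, rfl⟩]

theorem Entry.eval_congr {e : Entry V} {z z' : V → ℂ} (h : ∀ v, e.Has v → z v = z' v) :
    e.eval z = e.eval z' := by
  cases e with
  | zero => rfl
  | lit s c v => simp [Entry.eval, h v ⟨s, _, rfl⟩]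

theorem sign_mul_self (s : ℤˣ) : (((s : ℤ) : ℂ)) * ((s : ℤ) : ℂ) = 1 := by
  rcases Int.units_eq_one_or s with rfl | rfl <;> simp

variable [Fintype R] [DecidableEq C] [Fintype V]

/-- With `z v = 1` and every other variable zero, the `i`-th diagonal entry of `AᴴA` counts the rows
that hold `v` in column `i`. -/
theorem IsCODOn.existsUnique_row {A : Matrix R C (Entry V)} (h : IsCODOn A Finset.univ)
    (v : V) (i : C) : ∃! r, (A r i).Has v := by
  classical
  have key := h.sum_eq (fun w => if w = v then 1 else 0) i i
  have e : ∀ r, conj ((A r i).eval (fun w => if w = v then 1 else 0)) *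
      (A r i).eval (fun w => if w = v then 1 else 0) = if (A r i).Has v then 1 else 0 := by
    intro r
    by_cases hr : (A r i).Has v
    · obtain ⟨s, c, hs⟩ := hr
      have : (A r i).Has v := ⟨s, c, hs⟩
      rw [if_pos this, hs]
      simp [Entry.eval, sign_mul_self]
    · rw [if_neg hr, Entry.eval_eq_zero]
      · simp
      · intro w hw
        have : w ≠ v := by rintro rfl; exact hr hw
        simp [this]
  simp_rw [e] at key
  rw [← Finset.sum_filter] at key
  have e2 : ∀ w : V, ‖(if w = v then (1 : ℂ) else 0)‖ ^ 2 = if w = v then (1 : ℝ) else 0 := by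
    intro w; split_ifs <;> simp
  simp only [e2] at key
  simp at key
  have key' : (Finset.univ.filter fun r => (A r i).Has v).card = 1 := by exact_mod_cast key
  obtain ⟨r, hr⟩ := Finset.card_eq_one.1 key'
  refine ⟨r, ?_, fun r' hr' => ?_⟩
  · have : r ∈ Finset.univ.filter fun r => (A r i).Has v := by rw [hr]; simp
    simpa using this
  · have : r' ∈ Finset.univ.filter fun r => (A r i).Has v := by simpa using hr'
    rw [hr] at this
    simpa using this

/-- If one variable stood in both columns, then turning off all others would leave a single nonzero
term in an inner product that must vanish. -/
theorem IsCODOn.var_ne {A : Matrix R C (Entry V)} (h : IsCODOn A Finset.univ)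
    {r : R} {i j : C} (hij : i ≠ j) {v w : V} (hv : (A r i).Has v) (hw : (A r j).Has w) :
    v ≠ w := by
  classical
  rintro rfl
  have key := h.sum_eq (fun w => if w = v then 1 else 0) i j
  rw [if_neg hij, Fintype.sum_eq_single r] at key
  · obtain ⟨s, c, hs⟩ := hv
    obtain ⟨s', c', hs'⟩ := hw
    rw [hs, hs'] at key
    simp [Entry.eval] at key
  · intro r' hr'
    rw [Entry.eval_eq_zero (e := A r' i)]
    · simp
    · intro u hu
      have : u ≠ v := by
        rintro rfl
        exact hr' ((h.existsUnique_row u i).unique hu hv)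
      simp [this]

/-- With only `v` and `w` nonzero, the inner product of columns `i` and `j` has two terms: that of
`r` and that of the row `r'` with `w` in column `i`. Their cancellation puts `v` in column `j` of
`r'`. The values `(1, 1)` give the signs; `(I, 1)` and `(1, I)` give the conjugations. -/
theorem IsCODOn.partner {A : Matrix R C (Entry V)} (h : IsCODOn A Finset.univ)
    {r : R} {i j : C} (hij : i ≠ j) {s t : ℤˣ} {c d : Bool} {v w : V}
    (hv : A r i = .lit s c v) (hw : A r j = .lit t d w) :
    ∃ r' s' t', A r' i = .lit s' (!d) w ∧ A r' j = .lit t' (!c) v ∧ s * t * s' * t' = -1 := by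
  classical
  have hvw : v ≠ w := h.var_ne hij ⟨s, c, hv⟩ ⟨t, d, hw⟩
  obtain ⟨r', ⟨s', d', hr'⟩, -⟩ := h.existsUnique_row w i
  have hne : r ≠ r' := by
    rintro rfl
    rw [hv] at hr'
    cases hr'; exact hvw rfl
  have key : ∀ x y : ℂ, conj ((A r i).eval (fun u => if u = v then x else if u = w then y else 0)) *
      (A r j).eval (fun u => if u = v then x else if u = w then y else 0) +
      conj ((A r' i).eval (fun u => if u = v then x else if u = w then y else 0)) *
      (A r' j).eval (fun u => if u = v then x else if u = w then y else 0) = 0 := by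
    intro x y
    have key := h.sum_eq (fun u => if u = v then x else if u = w then y else 0) i j
    rw [if_neg hij, Fintype.sum_eq_add r r' hne] at key
    · exact key
    · intro q hq
      rw [Entry.eval_eq_zero (e := A q i)]
      · simp
      · intro u hu
        have h1 : u ≠ v := by
          rintro rfl
          exact hq.1 ((h.existsUnique_row u i).unique hu ⟨s, c, hv⟩)
        have h2 : u ≠ w := by
          rintro rfl
          exact hq.2 ((h.existsUnique_row u i).unique hu ⟨s', d', hr'⟩)
        simp [h1, h2]
  have hj : (A r' j).Has v := by
    by_contra hcon
    have k1 := key 1 1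
    rw [Entry.eval_eq_zero (e := A r' j), hv, hw] at k1
    · simp [Entry.eval, hvw.symm] at k1
    · intro u hu
      have h1 : u ≠ v := by rintro rfl; exact hcon hu
      have h2 : u ≠ w := by
        rintro rfl
        exact hne ((h.existsUnique_row u j).unique ⟨t, d, hw⟩ hu)
      simp [h1, h2]
  obtain ⟨t', c', ht'⟩ := hj
  rw [hv, hw, hr', ht'] at key
  have hst : s * t * s' * t' = -1 := by
    have k1 := key 1 1
    simp only [Entry.eval, if_true, hvw.symm, if_false] at k1
    rcases Int.units_eq_one_or s with rfl | rfl <;> rcases Int.units_eq_one_or t with rfl | rfl <;>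
    rcases Int.units_eq_one_or s' with rfl | rfl <;>
    rcases Int.units_eq_one_or t' with rfl | rfl <;>
    first | rfl | norm_num at k1
  have hsum : ∀ x y : ℂ, conj (if c then conj x else x) * (if d then conj y else y) =
      conj (if d' then conj y else y) * (if c' then conj x else x) := by
    intro x y
    have k1 := key x y
    simp only [Entry.eval, if_true, hvw.symm, if_false] at k1
    rcases Int.units_eq_one_or s with rfl | rfl <;> rcases Int.units_eq_one_or t with rfl | rfl <;>
    rcases Int.units_eq_one_or s' with rfl | rfl <;>
    rcases Int.units_eq_one_or t' with rfl | rfl <;>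
    first
    | (exfalso; revert hst; decide)
    | (simp only [map_mul, Complex.star_def] at k1
       simp only [Units.val_one, Int.cast_one, Units.val_neg, Int.cast_neg, map_neg, map_one] at k1
       linear_combination k1)
    | (simp only [map_mul, Complex.star_def] at k1
       simp only [Units.val_one, Int.cast_one, Units.val_neg, Int.cast_neg, map_neg, map_one] at k1
       linear_combination -k1)
  have hI : (Complex.I : ℂ) ≠ -Complex.I := fun hc => by
    have := congrArg Complex.im hc
    norm_num at this
  have hc : c' = !c := by
    have := hsum Complex.I 1
    cases c <;> cases c' <;> simp [hI, hI.symm] at this ⊢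
  have hd : d' = !d := by
    have := hsum 1 Complex.I
    cases d <;> cases d' <;> simp [hI, hI.symm] at this ⊢
  subst hc hd
  exact ⟨r', s', t', hr', ht', hst⟩

end Extraction

/-! ### Combinatorial form of the first type and atomic conditions. -/

/-- The combinatorial data of a first type complex orthogonal design: `row v i` is the row in which
`z v` occurs in column `i`, and `conj v i` tells whether it is conjugated there. -/
structure Design (R C V : Type) [Fintype C] [DecidableEq C] where
  supp : R → Finset C
  var : R → C → V
  row : V → C → R
  isConj : V → C → Bool
  sgn : R → C → ℤˣ
  var_row : ∀ v i, var (row v i) i = v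
  row_var : ∀ r, ∀ i ∈ supp r, row (var r i) i = r
  supp_row : ∀ v i, supp (row v i) = insert i (Finset.univ.filter fun j => isConj v j ≠ isConj v i)
  alam_row : ∀ r, ∀ i ∈ supp r, ∀ j ∈ supp r, i ≠ j → row (var r i) j = row (var r j) i
  alam_sgn : ∀ r, ∀ i ∈ supp r, ∀ j ∈ supp r, i ≠ j →
    sgn r i * sgn r j * sgn (row (var r i) j) i * sgn (row (var r i) j) j = -1

namespace Design

variable {R C V : Type} [Fintype C] [DecidableEq C]

/-- The design `D` describes the matrix `A`. -/
def Describes (D : Design R C V) (A : Matrix R C (Entry V)) : Prop :=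
  ∀ r i, A r i =
    if i ∈ D.supp r then .lit (D.sgn r i) (D.isConj (D.var r i) i) (D.var r i) else .zero

end Design

/-- First type enters only through `supp_row`. Alamouti blocks show that a nonzero entry in column
`j` of the row holding `v` in column `i` forces opposite conjugations of `v` in these columns.
Conversely, if the conjugations are opposite and that entry is zero, so is the other off-diagonal
one, and the forbidden submatrix appears. -/
theorem IsFirstType.exists_design {R C V : Type} [Fintype R] [Fintype C] [DecidableEq C]
    [Fintype V] [Nonempty V] {A : Matrix R C (Entry V)} (hA : IsCODOn A Finset.univ)
    (hF : IsFirstType A) : ∃ D : Design R C V, D.Describes A := by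
  classical
  choose row hrow huniq using hA.existsUnique_row
  choose s c hsc using hrow
  have hrow' : ∀ r i t d v, A r i = .lit t d v → r = row v i ∧ t = s v i ∧ d = c v i := by
    intro r i t d v h
    have h1 := huniq v i r ⟨t, d, h⟩
    subst h1
    have := hsc v i
    rw [h] at this
    cases this; simp
  have hvar : ∀ r i, ∃ v, A r i ≠ .zero → A r i = .lit (s v i) (c v i) v ∧ row v i = r := by
    intro r i
    cases h : A r i with
    | zero => exact ⟨Classical.arbitrary V, fun h => (h rfl).elim⟩
    | lit t d v =>
      obtain ⟨h1, h2, h3⟩ := hrow' r i t d v h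
      exact ⟨v, fun _ => ⟨by rw [h2, h3], h1.symm⟩⟩
  choose var hvar using hvar
  have hne : ∀ v i, A (row v i) i ≠ .zero := fun v i h => by rw [hsc] at h; cases h
  have var_row : ∀ v i, var (row v i) i = v := by
    intro v i
    have h1 := (hvar (row v i) i (hne v i)).1
    rw [hsc v i, Entry.lit.injEq] at h1
    exact h1.2.2.symm
  have partner : ∀ r i j, i ≠ j → A r i ≠ .zero → A r j ≠ .zero →
      row (var r i) j = row (var r j) i ∧ c (var r i) j = (!c (var r i) i) ∧
      s (var r i) i * s (var r j) j * s (var r j) i * s (var r i) j = -1 ∧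
      A (row (var r i) j) i ≠ .zero := by
    intro r i j hij hi hj
    obtain ⟨r', s', t', h1, h2, h3⟩ := hA.partner hij (hvar r i hi).1 (hvar r j hj).1
    obtain ⟨a1, a2, a3⟩ := hrow' _ _ _ _ _ h1
    obtain ⟨b1, b2, b3⟩ := hrow' _ _ _ _ _ h2
    refine ⟨by rw [← b1, ← a1], b3.symm, by rw [← a2, ← b2, h3], ?_⟩
    rw [← b1, h1]; simp
  have supp_row : ∀ v i j, i ≠ j → (A (row v i) j ≠ .zero ↔ c v j ≠ c v i) := by
    intro v i j hij
    constructor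
    · intro h
      have := (partner _ i j hij (hne v i) h).2.1
      rw [var_row] at this
      simp [this]
    · intro h h0
      have h0' : A (row v j) i = .zero := by
        by_contra h1
        have := (partner _ j i hij.symm (hne v j) h1).2.2.2
        rw [var_row] at this
        exact this h0
      cases hc : c v i with
      | false =>
        have hc' : c v j = true := by rw [hc] at h; simpa using h
        exact hF ⟨row v i, row v j, i, j, s v i, s v j, v, by rw [hsc, hc], h0, h0', by
          rw [hsc, hc']⟩
      | true =>
        have hc' : c v j = false := by rw [hc] at h; simpa using h
        exact hF ⟨row v j, row v i, j, i, s v j, s v i, v, by rw [hsc, hc'], h0', h0, by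
          rw [hsc, hc]⟩
  refine ⟨⟨fun r => Finset.univ.filter fun i => A r i ≠ .zero, var, row, c, fun r i => s (var r i) i,
    var_row, ?_, ?_, ?_, ?_⟩, ?_⟩
  · intro r i hi
    exact (hvar r i (by simpa using hi)).2
  · intro v i
    ext j
    by_cases hij : j = i
    · subst hij; simp [hne]
    · have := supp_row v i j (Ne.symm hij)
      simp only [Finset.mem_filter, Finset.mem_univ, true_and, Finset.mem_insert, hij, false_or]
      exact this
  · intro r i hi j hj hij
    exact (partner r i j hij (by simpa using hi) (by simpa using hj)).1
  · intro r i hi j hj hij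
    have h := partner r i j hij (by simpa using hi) (by simpa using hj)
    rw [var_row, h.1, var_row]
    exact h.2.2.1
  · intro r i
    by_cases h : A r i = .zero
    · simp [h]
    · simp [h, (hvar r i h).1.symm]

/-- An atomic design is connected through its variables. -/
theorem IsAtomic.eq_univ {R C V : Type} [Fintype R] [DecidableEq C] [Fintype V]
    {A : Matrix R C (Entry V)} (hA : IsCODOn A Finset.univ) (h : IsAtomic A) (S : Finset R)
    (hS : S.Nonempty) (W : V → Prop) (hW : ∀ r i v, (A r i).Has v → (r ∈ S ↔ W v)) :
    S = Finset.univ := by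
  classical
  by_contra hne
  refine h S hS hne ⟨Finset.univ.filter W, ?_, fun z => ?_⟩
  · rintro v ⟨r, i, s, c, hr⟩
    simpa using (hW _ i v ⟨s, c, hr⟩).1 r.2
  · ext i j
    -- Killing the variables outside `W` kills the rows outside `S` and does not affect those in
    -- `S`.
    have key := hA.sum_eq (fun v => if W v then z v else 0) i j
    rw [← Finset.sum_subset (Finset.subset_univ S), ← Finset.sum_coe_sort] at key
    · have e : ∀ (r : S) (i : C), (A r i).eval (fun v => if W v then z v else 0) =
          (A r i).eval z := by
        intro r i
        refine Entry.eval_congr fun v hv => ?_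
        simp [(hW _ i v hv).1 r.2]
      simp only [e] at key
      have e2 : ∑ v, ‖(if W v then z v else 0)‖ ^ 2 = ∑ v ∈ Finset.univ.filter W, ‖z v‖ ^ 2 := by
        rw [Finset.sum_filter]
        refine Finset.sum_congr rfl fun v _ => ?_
        split_ifs <;> simp
      rw [e2] at key
      simpa [Matrix.mul_apply, Matrix.one_apply] using key
    · intro r _ hr
      rw [Entry.eval_eq_zero (e := A r i)]
      · simp
      · intro v hv
        have : ¬ W v := fun hw => hr ((hW r i v hv).2 hw)
        simp [this]

/-! ### Coverings of the Johnson graph with commuting triangles are trivial. -/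

section Johnson

variable {ι X : Type*} [DecidableEq ι]

theorem card_sdiff_exchange {P Q : Finset ι} {i j : ι} (hi : i ∈ P) (hi' : i ∉ Q) (hj : j ∈ Q)
    (_ : j ∉ P) : (insert j (P.erase i) \ Q).card + 1 = (P \ Q).card := by
  have : insert j (P.erase i) \ Q = (P \ Q).erase i := by grind
  rw [this, Finset.card_erase_add_one (by grind)]

theorem card_exchange {P : Finset ι} {i j : ι} (hi : i ∈ P) (hj : j ∉ P) :
    (insert j (P.erase i)).card = P.card := by
  rw [Finset.card_insert_of_notMem (by grind), Finset.card_erase_add_one hi]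

theorem exchange_back {P : Finset ι} {i j : ι} (hi : i ∈ P) (hj : j ∉ P) :
    insert i ((insert j (P.erase i)).erase j) = P := by
  rw [Finset.erase_insert (by grind), Finset.insert_erase hi]

theorem card_sdiff_eq {P Q : Finset ι} (h : P.card = Q.card) : (P \ Q).card = (Q \ P).card :=
  Finset.card_sdiff_comm h

/-- Any two sets of the same size are joined by a sequence of exchanges. -/
theorem exchange_induction {Q : Finset ι → Prop} {P₀ : Finset ι} (h₀ : Q P₀)
    (step : ∀ P i j, P.card = P₀.card → i ∈ P → j ∉ P → Q P → Q (insert j (P.erase i)))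
    (P : Finset ι) (hP : P.card = P₀.card) : Q P := by
  induction hd : (P \ P₀).card generalizing P with
  | zero =>
    have h1 : P ⊆ P₀ := by simpa [Finset.sdiff_eq_empty_iff_subset] using hd
    rwa [Finset.eq_of_subset_of_card_le h1 hP.ge]
  | succ d ih =>
    obtain ⟨i, hi⟩ := Finset.card_pos.1 (by omega : 0 < (P \ P₀).card)
    obtain ⟨j, hj⟩ := Finset.card_pos.1 (by have := card_sdiff_eq hP; omega : 0 < (P₀ \ P).card)
    rw [Finset.mem_sdiff] at hi hj
    have h1 := card_sdiff_exchange hi.1 hi.2 hj.1 hj.2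
    have h2 := card_exchange hi.1 hj.2
    have h3 := step _ j i (h2.trans hP) (by simp) (by grind) (ih _ (h2.trans hP) (by omega))
    rwa [exchange_back hi.1 hj.2] at h3

/-- Moves `x ↦ mv x i j` over the exchanges `P ↦ P \ {i} ∪ {j}` of finite sets, such that the
moves over each triangle of exchanges commute. -/
structure ExchangeSystem (ι X : Type*) [DecidableEq ι] where
  supp : X → Finset ι
  mv : X → ι → ι → X
  supp_mv : ∀ x i j, i ∈ supp x → j ∉ supp x → supp (mv x i j) = insert j ((supp x).erase i)
  mv_mv_back : ∀ x i j, i ∈ supp x → j ∉ supp x → mv (mv x i j) j i = x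
  mv_mv_out : ∀ x i j k, i ∈ supp x → j ∉ supp x → k ∉ supp x → j ≠ k →
    mv (mv x i j) j k = mv x i k
  mv_mv_in : ∀ x i k j, i ∈ supp x → k ∈ supp x → i ≠ k → j ∉ supp x →
    mv (mv x i j) k i = mv x k j

namespace ExchangeSystem

variable (E : ExchangeSystem ι X)

/-- Both sides lie on triangles through `mv x a c`: its move `c → d` is `mv x a d`, and following
this by `b → c` amounts to `b → d`. -/
theorem mv_cross (x : X) (a b c d : ι) (ha : a ∈ E.supp x) (hb : b ∈ E.supp x) (hab : a ≠ b)
    (hc : c ∉ E.supp x) (hd : d ∉ E.supp x) (hcd : c ≠ d) :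
    E.mv (E.mv x a c) b d = E.mv (E.mv x a d) b c := by
  have h1 := E.supp_mv x a c ha hc
  rw [← E.mv_mv_out x a c d ha hc hd hcd]
  rw [E.mv_mv_in _ c b d (by grind) (by grind) (by grind) (by grind)]

theorem mv_comm (x : X) (a b c d : ι) (ha : a ∈ E.supp x) (hb : b ∈ E.supp x) (hab : a ≠ b)
    (hc : c ∉ E.supp x) (hd : d ∉ E.supp x) (hcd : c ≠ d) :
    E.mv (E.mv x a c) b d = E.mv (E.mv x b d) a c := by
  have h1 := E.supp_mv x a d ha hd
  rw [E.mv_cross x a b c d ha hb hab hc hd hcd]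
  rw [← E.mv_mv_in x a b d ha hb hab hd]
  have h2 := E.supp_mv (E.mv x a d) b a (by grind) (by grind)
  rw [E.mv_mv_out _ b a c (by grind) (by grind) (by grind) (by grind)]

open Classical in
/-- An element of a finite set. -/
noncomputable def pick [Nonempty ι] (s : Finset ι) : ι :=
  if h : s.Nonempty then h.choose else Classical.arbitrary ι

omit [DecidableEq ι] in
theorem pick_mem [Nonempty ι] {s : Finset ι} (h : s.Nonempty) : pick s ∈ s := by
  rw [pick, dif_pos h]; exact h.choose_spec

/-- Transport towards `P₀` by `d` chosen moves. -/
noncomputable def toward [Nonempty ι] (P₀ : Finset ι) : ℕ → X → X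
  | 0, x => x
  | d + 1, x => toward P₀ d (E.mv x (pick (E.supp x \ P₀)) (pick (P₀ \ E.supp x)))

variable [Nonempty ι] {P₀ : Finset ι}

/-- Transport to `P₀` does not depend on the first approaching move. At distance one there is no
choice. Further away, two first moves are completed by second moves to a common point (`mv_comm`,
`mv_cross`), and induction makes every second move admissible. -/
theorem toward_succ_eq {d : ℕ} {x : X} (hx : (E.supp x).card = P₀.card)
    (hd : (E.supp x \ P₀).card = d + 1) {i j : ι} (hi : i ∈ E.supp x \ P₀)
    (hj : j ∈ P₀ \ E.supp x) : E.toward P₀ d (E.mv x i j) = E.toward P₀ (d + 1) x := by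
  induction d generalizing x i j with
  | zero =>
    obtain ⟨a, ha⟩ := Finset.card_eq_one.1 hd
    obtain ⟨b, hb⟩ := Finset.card_eq_one.1 ((card_sdiff_eq hx).symm.trans hd)
    have h1 : i = pick (E.supp x \ P₀) := by
      have := pick_mem ⟨i, hi⟩
      grind
    have h2 : j = pick (P₀ \ E.supp x) := by
      have := pick_mem ⟨j, hj⟩
      grind
    rw [h1, h2]; rfl
  | succ d ih =>
    have step : ∀ a b c e, a ∈ E.supp x \ P₀ → b ∈ E.supp x \ P₀ → a ≠ b →
        c ∈ P₀ \ E.supp x → e ∈ P₀ \ E.supp x → c ≠ e →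
        E.toward P₀ (d + 1) (E.mv x a c) = E.toward P₀ d (E.mv (E.mv x a c) b e) := by
      intro a b c e ha hb hab hc he hce
      rw [Finset.mem_sdiff] at ha hb hc he
      have h1 := E.supp_mv x a c ha.1 hc.2
      have h2 := card_exchange ha.1 hc.2
      have h3 := card_sdiff_exchange ha.1 ha.2 hc.1 hc.2
      rw [← h1] at h2 h3
      exact (ih (by omega) (by omega) (by grind) (by grind)).symm
    have pair : ∀ a b c e, a ∈ E.supp x \ P₀ → b ∈ E.supp x \ P₀ → a ≠ b →
        c ∈ P₀ \ E.supp x → e ∈ P₀ \ E.supp x → c ≠ e →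
        E.toward P₀ (d + 1) (E.mv x a c) = E.toward P₀ (d + 1) (E.mv x b e) := by
      intro a b c e ha hb hab hc he hce
      rw [step a b c e ha hb hab hc he hce, step b a e c hb ha hab.symm he hc hce.symm]
      rw [E.mv_comm] <;> grind
    have cross : ∀ a b c e, a ∈ E.supp x \ P₀ → b ∈ E.supp x \ P₀ → a ≠ b →
        c ∈ P₀ \ E.supp x → e ∈ P₀ \ E.supp x → c ≠ e →
        E.toward P₀ (d + 1) (E.mv x a c) = E.toward P₀ (d + 1) (E.mv x a e) := by
      intro a b c e ha hb hab hc he hce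
      rw [step a b c e ha hb hab hc he hce, step a b e c ha hb hab he hc hce.symm]
      rw [E.mv_cross] <;> grind
    have hI := pick_mem ⟨i, hi⟩
    have hJ := pick_mem ⟨j, hj⟩
    change _ = E.toward P₀ (d + 1) (E.mv x (pick (E.supp x \ P₀)) (pick (P₀ \ E.supp x)))
    have hcard := (card_sdiff_eq hx).symm.trans hd
    have e1 : ∀ a, ∃ b ∈ E.supp x \ P₀, a ≠ b := by
      intro a
      obtain ⟨b, hb, hb'⟩ := Finset.exists_mem_ne (s := E.supp x \ P₀) (by omega) a
      exact ⟨b, hb, hb'.symm⟩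
    have e2 : ∀ a, ∃ b ∈ P₀ \ E.supp x, a ≠ b := by
      intro a
      obtain ⟨b, hb, hb'⟩ := Finset.exists_mem_ne (s := P₀ \ E.supp x) (by omega) a
      exact ⟨b, hb, hb'.symm⟩
    generalize pick (E.supp x \ P₀) = I at *
    generalize pick (P₀ \ E.supp x) = J at *
    by_cases hiI : i = I
    · subst hiI
      by_cases hjJ : j = J
      · rw [hjJ]
      · obtain ⟨b, hb, hab⟩ := e1 i
        exact cross i b j J hi hb hab hj hJ hjJ
    · by_cases hjJ : j = J
      · subst hjJ
        obtain ⟨b, hb, hab⟩ := e2 j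
        exact (cross i I j b hi hI hiI hj hb hab).trans
          (pair i I b j hi hI hiI hb hj hab.symm)
      · exact pair i I j J hi hI hiI hj hJ hjJ

/-- Transport to the fibre of `P₀`. -/
noncomputable def toBase (P₀ : Finset ι) (x : X) : X := E.toward P₀ (E.supp x \ P₀).card x

theorem toBase_mv_closer {x : X} (hx : (E.supp x).card = P₀.card) {i j : ι}
    (hi : i ∈ E.supp x) (hi' : i ∉ P₀) (hj : j ∈ P₀) (hj' : j ∉ E.supp x) :
    E.toBase P₀ (E.mv x i j) = E.toBase P₀ x := by
  have h1 := card_sdiff_exchange hi hi' hj hj'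
  rw [toBase, toBase, E.supp_mv x i j hi hj', ← h1]
  exact E.toward_succ_eq hx h1.symm (by grind) (by grind)

/-- A move away from `P₀` is the inverse of an approaching one. A move that keeps the distance is
one side of a triangle whose third vertex is closer to `P₀`. -/
theorem toBase_mv {x : X} (hx : (E.supp x).card = P₀.card) {i j : ι}
    (hi : i ∈ E.supp x) (hj : j ∉ E.supp x) :
    E.toBase P₀ (E.mv x i j) = E.toBase P₀ x := by
  have h1 := E.supp_mv x i j hi hj
  have h2 : (E.supp (E.mv x i j)).card = P₀.card := by rw [h1, card_exchange hi hj, hx]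
  by_cases hi' : i ∈ P₀ <;> by_cases hj' : j ∈ P₀
  · obtain ⟨c, hc⟩ : (E.supp x \ P₀).Nonempty := by
      rw [← Finset.card_pos, card_sdiff_eq hx, Finset.card_pos]
      exact ⟨j, by grind⟩
    rw [Finset.mem_sdiff] at hc
    rw [← E.toBase_mv_closer h2 (i := c) (j := i) (by grind) hc.2 hi' (by grind),
      E.mv_mv_in x i c j hi hc.1 (by grind) hj, E.toBase_mv_closer hx hc.1 hc.2 hj' hj]
  · rw [← E.toBase_mv_closer h2 (i := j) (j := i) (by grind) hj' hi' (by grind),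
      E.mv_mv_back x i j hi hj]
  · exact E.toBase_mv_closer hx hi hi' hj' hj
  · obtain ⟨c, hc⟩ : (P₀ \ E.supp x).Nonempty := by
      rw [← Finset.card_pos, ← card_sdiff_eq hx, Finset.card_pos]
      exact ⟨i, by grind⟩
    rw [Finset.mem_sdiff] at hc
    rw [← E.toBase_mv_closer h2 (i := j) (j := c) (by grind) hj' hc.1 (by grind),
      E.mv_mv_out x i j c hi hj hc.2 (by grind), E.toBase_mv_closer hx hi hi' hc.1 hc.2]

/-- The chosen moves depend only on the support, and each of them is invertible. -/
theorem toward_injective {d : ℕ} {x y : X} (hx : (E.supp x).card = P₀.card)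
    (hxy : E.supp x = E.supp y) (hd : (E.supp x \ P₀).card = d)
    (h : E.toward P₀ d x = E.toward P₀ d y) : x = y := by
  induction d generalizing x y with
  | zero => exact h
  | succ d ih =>
    have h1 : (E.supp x \ P₀).Nonempty := Finset.card_pos.1 (by omega)
    have h2 : (P₀ \ E.supp x).Nonempty := Finset.card_pos.1 (by have := card_sdiff_eq hx; omega)
    have hI := pick_mem h1
    have hJ := pick_mem h2
    rw [toward, toward, ← hxy] at h
    generalize pick (E.supp x \ P₀) = I at *
    generalize pick (P₀ \ E.supp x) = J at *
    rw [Finset.mem_sdiff] at hI hJ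
    have h3 := E.supp_mv x I J hI.1 hJ.2
    have h4 := E.supp_mv y I J (hxy ▸ hI.1) (hxy ▸ hJ.2)
    have h5 := card_exchange hI.1 hJ.2
    have h6 := card_sdiff_exchange hI.1 hI.2 hJ.1 hJ.2
    have := ih (by rw [h3, h5, hx]) (by rw [h3, h4, hxy]) (by rw [h3]; omega) h
    rw [← E.mv_mv_back x I J hI.1 hJ.2, this, E.mv_mv_back y I J (hxy ▸ hI.1) (hxy ▸ hJ.2)]

omit [Nonempty ι] in
/-- Through every point there is a section which is compatible with all moves. -/
theorem exists_section (x₀ : X) : ∃ F : Finset ι → X, F (E.supp x₀) = x₀ ∧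
    ∀ P, P.card = (E.supp x₀).card → E.supp (F P) = P ∧
      ∀ i ∈ P, ∀ j ∉ P, E.mv (F P) i j = F (insert j (P.erase i)) := by
  classical
  rcases isEmpty_or_nonempty ι with hι | hι
  · exact ⟨fun _ => x₀, rfl, fun P _ => ⟨Subsingleton.elim _ _, fun i => (hι.false i).elim⟩⟩
  -- The section picks over `P` the only point that is transported to the same place as `x₀`.
  have ex : ∀ P, P.card = (E.supp x₀).card →
      ∃ x, E.supp x = P ∧ E.toBase (E.supp x₀) x = E.toBase (E.supp x₀) x₀ := by
    refine exchange_induction ⟨x₀, rfl, rfl⟩ ?_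
    rintro P i j hP hi hj ⟨x, rfl, hx⟩
    exact ⟨E.mv x i j, E.supp_mv x i j hi hj, (E.toBase_mv hP hi hj).trans hx⟩
  have uniq : ∀ x y, (E.supp x).card = (E.supp x₀).card → E.supp x = E.supp y →
      E.toBase (E.supp x₀) x = E.toBase (E.supp x₀) y → x = y := by
    intro x y hx hxy h
    refine E.toward_injective hx hxy rfl ?_
    rw [toBase, toBase, ← hxy] at h
    exact h
  have : Nonempty X := ⟨x₀⟩
  choose! F hF hF' using ex
  refine ⟨F, uniq _ _ ?_ (hF _ rfl) (hF' _ rfl), fun P hP => ⟨hF P hP, fun i hi j hj => ?_⟩⟩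
  · rw [hF _ rfl]
  have hc := card_exchange hi hj
  have hs : E.supp (E.mv (F P) i j) = insert j (P.erase i) := by
    rw [E.supp_mv _ _ _ (by rwa [hF P hP]) (by rwa [hF P hP]), hF P hP]
  refine uniq _ _ ?_ ?_ ?_
  · rw [hs, hc, hP]
  · rw [hs, hF _ (hc.trans hP)]
  · rw [E.toBase_mv (by rw [hF P hP, hP]) (by rwa [hF P hP]) (by rwa [hF P hP]), hF' P hP,
      hF' _ (hc.trans hP)]

end ExchangeSystem

end Johnson

/-! ### Incidence signs of subsets. -/

section PosSign

variable {n : ℕ}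

theorem units_mul_mul_self (a b : ℤˣ) : a * (a * b) = b := by
  rw [← mul_assoc, Int.units_mul_self, one_mul]

theorem eq_neg_of_mul_eq_neg_one {a b c d : ℤˣ} (h : a * b * c * d = -1) :
    d = -(a * b * c) := by
  rw [← units_mul_mul_self (a * b * c) d, h, mul_neg_one]

/-- The incidence sign `(-1) ^ #{j ∈ V | j < i}`. -/
def posSign (V : Finset (Fin n)) (i : Fin n) : ℤˣ := (-1) ^ (V.filter (· < i)).card

theorem posSign_erase (V : Finset (Fin n)) (i : Fin n) :
    posSign (V.erase i) i = posSign V i := by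
  unfold posSign
  congr 2
  ext j; simp only [Finset.mem_filter, Finset.mem_erase]; grind

theorem posSign_insert (V : Finset (Fin n)) (i : Fin n) :
    posSign (insert i V) i = posSign V i := by
  unfold posSign
  congr 2
  ext j; simp only [Finset.mem_filter, Finset.mem_insert]; grind

theorem posSign_insert_of_lt {V : Finset (Fin n)} {i j : Fin n} (hj : j ∉ V) (h : j < i) :
    posSign (insert j V) i = -posSign V i := by
  unfold posSign
  rw [Finset.filter_insert, if_pos h, Finset.card_insert_of_notMem (by simp [hj]), pow_succ,
    mul_neg_one]

theorem posSign_insert_of_gt {V : Finset (Fin n)} {i j : Fin n} (h : i < j) :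
    posSign (insert j V) i = posSign V i := by
  unfold posSign
  rw [Finset.filter_insert, if_neg h.not_gt]

/-- This is the relation `alam_sgn` for the standard signs; hence the signs of a design divided by
them satisfy the relation with `1` in place of `-1`. -/
theorem posSign_square {V : Finset (Fin n)} {i j : Fin n} (hi : i ∉ V) (hj : j ∉ V)
    (hij : i ≠ j) :
    posSign V i * posSign V j * posSign (insert i V) j * posSign (insert j V) i = -1 := by
  rcases lt_or_gt_of_ne hij with h | h
  · rw [posSign_insert_of_lt hi h, posSign_insert_of_gt h]
    simp [mul_comm, mul_left_comm, Int.units_mul_self]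
  · rw [posSign_insert_of_lt hj h, posSign_insert_of_gt h]
    simp [mul_comm, mul_left_comm, Int.units_mul_self]

theorem posSign_compl (V : Finset (Fin n)) (i : Fin n) :
    posSign Vᶜ i = (-1) ^ (i : ℕ) * posSign V i := by
  have h3 : posSign V i * posSign Vᶜ i = (-1) ^ (i : ℕ) := by
    rw [posSign, posSign, ← pow_add, ← Finset.card_union_of_disjoint]
    · have : V.filter (· < i) ∪ Vᶜ.filter (· < i) = Finset.Iio i := by
        ext k; simp only [Finset.mem_union, Finset.mem_filter, Finset.mem_compl, Finset.mem_Iio]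
        tauto
      rw [this, Fin.card_Iio]
    · exact Finset.disjoint_filter_filter (disjoint_compl_right)
  rw [← h3]
  simp [mul_comm, units_mul_mul_self]

end PosSign

/-! ### Exchange moves on rows, with signs, and the sheet through a row. -/

namespace Design

section Basic

variable {R C V : Type} [Fintype C] [DecidableEq C] (D : Design R C V)

/-- The columns in which `v` is conjugated in the opposite way as in column `i`. -/
def opp (v : V) (i : C) : Finset C := Finset.univ.filter fun j => D.isConj v j ≠ D.isConj v i

variable {D}

theorem mem_opp {v : V} {i j : C} : j ∈ D.opp v i ↔ D.isConj v j ≠ D.isConj v i := by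
  simp [opp]

theorem notMem_opp_self (v : V) (i : C) : i ∉ D.opp v i := by simp [opp]

theorem supp_row_eq (v : V) (i : C) : D.supp (D.row v i) = insert i (D.opp v i) := D.supp_row v i

theorem mem_supp_row (v : V) (i : C) : i ∈ D.supp (D.row v i) := by simp [supp_row_eq]

theorem erase_supp {r : R} {i : C} (hi : i ∈ D.supp r) :
    (D.supp r).erase i = D.opp (D.var r i) i := by
  conv_lhs => rw [← D.row_var r i hi]
  rw [supp_row_eq, Finset.erase_insert (notMem_opp_self _ _)]

theorem opp_eq_of_notMem {v : V} {i j : C} (hj : j ∉ D.opp v i) : D.opp v j = D.opp v i := by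
  rw [mem_opp, not_not] at hj
  ext k; rw [mem_opp, mem_opp, hj]

theorem opp_eq_compl_of_mem {v : V} {i j : C} (hj : j ∈ D.opp v i) :
    D.opp v j = (D.opp v i)ᶜ := by
  rw [mem_opp] at hj
  ext k; rw [Finset.mem_compl, mem_opp, mem_opp]
  revert hj; cases D.isConj v i <;> cases D.isConj v j <;> cases D.isConj v k <;> simp

theorem supp_row_exchange {r : R} {i j : C} (hi : i ∈ D.supp r) (hj : j ∉ D.supp r) :
    D.supp (D.row (D.var r i) j) = insert j ((D.supp r).erase i) := by
  have h : j ∉ D.opp (D.var r i) i := by rw [← erase_supp hi]; simp [hj]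
  rw [supp_row_eq, opp_eq_of_notMem h, erase_supp hi]

/-- Three Alamouti blocks suffice: columns `i, k` of `r`, columns `j, k` of the row reached by `i →
j`, and columns `i, j` of the row common to both blocks. -/
theorem row_row_in {r : R} {i k j : C} (hi : i ∈ D.supp r) (hk : k ∈ D.supp r) (hik : i ≠ k)
    (hj : j ∉ D.supp r) :
    D.row (D.var (D.row (D.var r i) j) k) j = D.row (D.var r i) k ∧
    D.row (D.var (D.row (D.var r i) j) k) i = D.row (D.var r k) j := by
  have hs := supp_row_exchange hi hj
  have hjk : j ≠ k := by rintro rfl; exact hj hk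
  have h1 := D.alam_row r i hi k hk hik
  have h2 := D.alam_row (D.row (D.var r i) j) j (mem_supp_row _ _) k
    (by rw [hs]; simp [hik.symm, hk]) hjk
  rw [D.var_row] at h2
  refine ⟨h2.symm, ?_⟩
  have hij : i ≠ j := by rintro rfl; exact hj hi
  have h3 := D.alam_row (D.row (D.var r i) k) i (by rw [h1]; exact mem_supp_row _ _) j
    (by rw [h2]; exact mem_supp_row _ _) hij
  rw [h1, D.var_row, ← h1, h2, D.var_row] at h3
  exact h3.symm

end Basic

section Signed

variable {n : ℕ} {R V : Type} (D : Design R (Fin n) V)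

/-- The rows with signs, with the exchanges that move the variable in column `i` to column `j`. -/
def signedRows : ExchangeSystem (Fin n) (ℤˣ × R) where
  supp x := D.supp x.2
  -- Both incidence signs refer to the same set, the support without `i`, as `posSign_erase` shows.
  -- So moves of one variable compose by telescoping.
  mv x i j := (x.1 * (D.sgn x.2 i * posSign (D.supp x.2) i) *
    (D.sgn (D.row (D.var x.2 i) j) j * posSign ((D.supp x.2).erase i) j), D.row (D.var x.2 i) j)
  supp_mv x i j hi hj := supp_row_exchange hi hj
  mv_mv_back x i j hi hj := by
    have hs := supp_row_exchange hi hj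
    have h1 : ((D.supp (D.row (D.var x.2 i) j)).erase j) = (D.supp x.2).erase i := by
      rw [hs, Finset.erase_insert (by simp [hj])]
    ext1
    · simp only [D.var_row, D.row_var _ _ hi, h1, ← posSign_erase (D.supp x.2) i]
      rw [← posSign_erase (D.supp (D.row (D.var x.2 i) j)) j, h1]
      simp [mul_comm, mul_left_comm, units_mul_mul_self, Int.units_mul_self]
    · simp only [D.var_row, D.row_var _ _ hi]
  mv_mv_out x i j k hi hj hk hjk := by
    have hs := supp_row_exchange hi hj
    have h1 : ((D.supp (D.row (D.var x.2 i) j)).erase j) = (D.supp x.2).erase i := by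
      rw [hs, Finset.erase_insert (by simp [hj])]
    ext1
    · simp only [D.var_row, h1]
      rw [← posSign_erase (D.supp (D.row (D.var x.2 i) j)) j, h1]
      simp [mul_comm, mul_left_comm, mul_assoc, units_mul_mul_self, Int.units_mul_self]
    · simp only [D.var_row]
  mv_mv_in x i k j hi hk hik hj := by
    obtain ⟨e1, e2⟩ := row_row_in hi hk hik hj
    have hs := supp_row_exchange hi hj
    have hjk : j ≠ k := by rintro rfl; exact hj hk
    have hij : i ≠ j := by rintro rfl; exact hj hi
    ext1
    · simp only [e2]
      obtain ⟨W, hW, hiW, hkW⟩ : ∃ W, D.supp x.2 = insert i (insert k W) ∧ i ∉ W ∧ k ∉ W :=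
        ⟨((D.supp x.2).erase i).erase k, by
          rw [Finset.insert_erase (by simp [hk, hik.symm]), Finset.insert_erase hi],
          by simp, by simp⟩
      have hjW : j ∉ W := by rw [hW] at hj; simp at hj; tauto
      have hPi : (D.supp x.2).erase i = insert k W := by
        rw [hW, Finset.erase_insert (by simp [hik, hiW])]
      have hPk : (D.supp x.2).erase k = insert i W := by
        rw [hW, Finset.insert_comm, Finset.erase_insert (by simp [hik.symm, hkW])]
      have hP1 : (D.supp (D.row (D.var x.2 i) j)).erase k = insert j W := by
        rw [hs, hPi, Finset.insert_comm, Finset.erase_insert (by simp [hjk.symm, hkW])]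
      rw [← posSign_erase (D.supp (D.row (D.var x.2 i) j)) k, ← posSign_erase (D.supp x.2) i,
        ← posSign_erase (D.supp x.2) k, hP1, hPi, hPk]
      -- Three Alamouti relations `s1`, `s2`, `s3` and three incidence relations `t1`, `t2`, `t3`
      -- over `W` contribute `-1` each, and these signs cancel.
      have h1 := D.alam_row x.2 i hi k hk hik
      have s1 := eq_neg_of_mul_eq_neg_one (D.alam_sgn x.2 k hk i hi hik.symm)
      have s2 := eq_neg_of_mul_eq_neg_one (D.alam_sgn (D.row (D.var x.2 i) j) k
        (by rw [hs]; simp [hik.symm, hk]) j (mem_supp_row _ _) hjk.symm)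
      have s3 := eq_neg_of_mul_eq_neg_one (D.alam_sgn (D.row (D.var x.2 i) k) i
        (by rw [h1]; exact mem_supp_row _ _) j (by rw [← e1]; exact mem_supp_row _ _) hij)
      have e3 : D.var (D.row (D.var x.2 i) k) i = D.var x.2 k := by rw [h1, D.var_row]
      rw [e1] at s2
      rw [e3] at s3
      rw [← h1] at s1
      have t1 := eq_neg_of_mul_eq_neg_one (posSign_square hiW hkW hik)
      have t2 := eq_neg_of_mul_eq_neg_one (posSign_square hjW hkW hjk)
      have t3 := eq_neg_of_mul_eq_neg_one (posSign_square hiW hjW hij)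
      rw [s3, s1, s2, t1, t2, t3]
      simp [mul_comm, mul_left_comm, mul_assoc, units_mul_mul_self]
    · exact e2

/-- A sheet of `D` over the subsets of sizes `m - 1`, `m`, `m + 1` of the columns: `F P` is a row
with nonzero columns `P`, `F' S` one with nonzero columns `Sᶜ`, and `v U` is the common variable of
the rows `F (insert i U)`, `i ∉ U`, and `F' (U.erase i)`, `i ∈ U`. -/
structure Sheet (m : ℕ) where
  F : Finset (Fin n) → R
  F' : Finset (Fin n) → R
  v : Finset (Fin n) → V
  κ : Finset (Fin n) → Bool
  g : Finset (Fin n) → ℤˣ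
  g' : Finset (Fin n) → ℤˣ
  gv : Finset (Fin n) → ℤˣ
  supp_F : ∀ P, P.card = m + 1 → D.supp (F P) = P
  supp_F' : ∀ S, S.card + 1 = m → D.supp (F' S) = Sᶜ
  row_v : ∀ U, U.card = m → ∀ i, i ∉ U → D.row (v U) i = F (insert i U)
  row_v' : ∀ U, U.card = m → ∀ i, i ∈ U → D.row (v U) i = F' (U.erase i)
  isConj_v : ∀ U, U.card = m → ∀ i, D.isConj (v U) i = xor (κ U) (decide (i ∈ U))
  sgn_F : ∀ U, U.card = m → ∀ i, i ∉ U →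
    D.sgn (F (insert i U)) i = g (insert i U) * gv U * posSign U i
  sgn_F' : ∀ U, U.card = m → ∀ i, i ∈ U →
    D.sgn (F' (U.erase i)) i = g' (U.erase i) * gv U * posSign U i

/-- The section through `(1, r₀)` gives the rows `F P` and their signs `g P`. The moves between the
sets `insert i U` preserve both the variable in the moving column and the weighted sign, whence `v
U` and `gv U`. -/
theorem exists_sheet {m : ℕ} (hm : 0 < m) (hn : n = 2 * m) (r₀ : R)
    (h₀ : (D.supp r₀).card = m + 1) : Nonempty (D.Sheet m) := by
  obtain ⟨X, -, hX⟩ := D.signedRows.exists_section (1, r₀)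
  have hX1 : ∀ P, P.card = m + 1 → D.supp (X P).2 = P := fun P hP => (hX P (hP.trans h₀.symm)).1
  -- A reference column `o U` outside `U` exists because `m < 2 * m`; all data indexed by `U` are
  -- read off there.
  have out : ∀ U : Finset (Fin n), ∃ i, U.card ≤ m → i ∉ U := by
    intro U
    by_cases hU : U.card ≤ m
    · obtain ⟨i, hi⟩ : ∃ i, i ∉ U := by
        by_contra! hcon
        have := Finset.card_eq_of_equiv_fin (Equiv.subtypeUnivEquiv hcon)
        omega
      exact ⟨i, fun _ => hi⟩
    · exact ⟨⟨0, by omega⟩, fun h => (hU h).elim⟩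
  choose o ho using out
  have card_ins : ∀ (U : Finset (Fin n)) i, i ∉ U → (insert i U).card = U.card + 1 :=
    fun U i hi => Finset.card_insert_of_notMem hi
  have hmv : ∀ U : Finset (Fin n), U.card = m → ∀ i ∉ U, ∀ j ∉ U, j ≠ i →
      D.signedRows.mv (X (insert i U)) i j = X (insert j U) := by
    intro U hU i hi j hj hij
    rw [(hX _ (by rw [card_ins U i hi, hU]; exact h₀.symm)).2 i (by simp) j
      (by simp [hij, hj]), Finset.erase_insert hi]
  have hv1 : ∀ U : Finset (Fin n), U.card = m → ∀ i ∉ U,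
      D.var (X (insert i U)).2 i = D.var (X (insert (o U) U)).2 (o U) := by
    intro U hU i hi
    by_cases hio : i = o U
    · rw [← hio]
    · rw [← hmv U hU _ (ho U hU.le) i hi hio]
      exact D.var_row _ _
  have hv2 : ∀ U : Finset (Fin n), U.card = m → ∀ i ∉ U,
      (X (insert i U)).1 * D.sgn (X (insert i U)).2 i * posSign U i =
      (X (insert (o U) U)).1 * D.sgn (X (insert (o U) U)).2 (o U) * posSign U (o U) := by
    intro U hU i hi
    by_cases hio : i = o U
    · rw [← hio]
    · have h1 := congrArg Prod.fst (hmv U hU _ (ho U hU.le) i hi hio)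
      have h2 := congrArg Prod.snd (hmv U hU _ (ho U hU.le) i hi hio)
      simp only [signedRows] at h1 h2
      rw [h2, hX1 _ (by rw [card_ins U _ (ho U hU.le), hU]), Finset.erase_insert (ho U hU.le),
        posSign_insert] at h1
      rw [← h1]
      simp [mul_comm, mul_left_comm, mul_assoc, units_mul_mul_self]
  obtain ⟨v, hv⟩ : ∃ v : Finset (Fin n) → V, ∀ U : Finset (Fin n), U.card = m → ∀ i ∉ U,
      D.var (X (insert i U)).2 i = v U := ⟨_, hv1⟩
  obtain ⟨gv, hgv⟩ : ∃ gv : Finset (Fin n) → ℤˣ, ∀ U : Finset (Fin n), U.card = m → ∀ i ∉ U,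
      (X (insert i U)).1 * D.sgn (X (insert i U)).2 i * posSign U i = gv U := ⟨_, hv2⟩
  have hsgn : ∀ U : Finset (Fin n), U.card = m → ∀ i ∉ U,
      D.sgn (X (insert i U)).2 i = (X (insert i U)).1 * gv U * posSign U i := by
    intro U hU i hi
    rw [← hgv U hU i hi]
    simp [mul_comm, mul_left_comm, units_mul_mul_self]
  have hrow : ∀ U : Finset (Fin n), U.card = m → ∀ i ∉ U, D.row (v U) i = (X (insert i U)).2 := by
    intro U hU i hi
    rw [← hv U hU i hi]
    exact D.row_var _ _ (by rw [hX1 _ (by rw [card_ins U i hi, hU])]; simp)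
  have hopp : ∀ U : Finset (Fin n), U.card = m → ∀ i ∉ U, D.opp (v U) i = U := by
    intro U hU i hi
    have := hX1 _ (by rw [card_ins U i hi, hU])
    rw [← hv U hU i hi, ← erase_supp (by rw [this]; simp), this, Finset.erase_insert hi]
  have hopp' : ∀ U : Finset (Fin n), U.card = m → ∀ i ∈ U, D.opp (v U) i = Uᶜ := by
    intro U hU i hi
    rw [opp_eq_compl_of_mem (i := o U) (by rwa [hopp U hU _ (ho U hU.le)]),
      hopp U hU _ (ho U hU.le)]
  -- The Alamouti block in columns `i, j` of the row over `S ∪ {i, j}` shows that `F' S` and its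
  -- sign do not depend on the column used to define them.
  have hdown : ∀ S : Finset (Fin n), S.card + 1 = m → ∀ i ∉ S, ∀ j ∉ S, i ≠ j →
      D.row (v (insert i S)) i = D.row (v (insert j S)) j ∧
      D.sgn (D.row (v (insert i S)) i) i * gv (insert i S) * posSign S i =
      D.sgn (D.row (v (insert j S)) j) j * gv (insert j S) * posSign S j := by
    intro S hS i hi j hj hij
    have hiU : i ∉ insert j S := by simp [hij, hi]
    have hjU : j ∉ insert i S := by simp [hij.symm, hj]
    have hci : (insert i S).card = m := by rw [card_ins S i hi, hS]
    have hcj : (insert j S).card = m := by rw [card_ins S j hj, hS]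
    have hs := hX1 (insert i (insert j S)) (by rw [card_ins _ i hiU, hcj])
    have hi1 := hv _ hcj i hiU
    have hj1 := hv _ hci j hjU
    have hi2 := hsgn _ hcj i hiU
    have hj2 := hsgn _ hci j hjU
    rw [Finset.insert_comm] at hj1 hj2
    have a1 := D.alam_row _ i (by rw [hs]; simp) j (by rw [hs]; simp) hij
    have a2 := D.alam_sgn _ i (by rw [hs]; simp) j (by rw [hs]; simp) hij
    rw [a1] at a2
    rw [hi1, hj1] at a1
    rw [hj1, hi2, hj2] at a2
    refine ⟨a1.symm, ?_⟩
    rw [← a1] at a2 ⊢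
    have a3 := eq_neg_of_mul_eq_neg_one a2
    rw [a3, eq_neg_of_mul_eq_neg_one (posSign_square hi hj hij)]
    simp [mul_comm, mul_left_comm, mul_assoc, units_mul_mul_self, Int.units_mul_self]
  have hdown' : ∀ U : Finset (Fin n), U.card = m → ∀ i ∈ U,
      D.row (v U) i = D.row (v (insert (o (U.erase i)) (U.erase i))) (o (U.erase i)) ∧
      D.sgn (D.row (v U) i) i * gv U * posSign U i =
      D.sgn (D.row (v (insert (o (U.erase i)) (U.erase i))) (o (U.erase i))) (o (U.erase i)) *
        gv (insert (o (U.erase i)) (U.erase i)) * posSign (U.erase i) (o (U.erase i)) := by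
    intro U hU i hi
    have hc := Finset.card_erase_add_one hi
    have h1 := ho (U.erase i) (by omega)
    by_cases hio : i = o (U.erase i)
    · rw [← hio, Finset.insert_erase hi, posSign_erase]; simp
    · have := hdown (U.erase i) (by omega) i (by simp) _ h1 hio
      rwa [Finset.insert_erase hi, posSign_erase] at this
  refine ⟨⟨fun P => (X P).2, fun S => D.row (v (insert (o S) S)) (o S), v,
    fun U => D.isConj (v U) (o U), fun P => (X P).1,
    fun S => D.sgn (D.row (v (insert (o S) S)) (o S)) (o S) * gv (insert (o S) S) *
      posSign S (o S), gv, hX1, ?_, hrow, fun U hU i hi => (hdown' U hU i hi).1, ?_, hsgn, ?_⟩⟩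
  · intro S hS
    have h1 := ho S (by omega)
    rw [supp_row_eq, hopp' _ (by rw [card_ins S _ h1, hS]) _ (by simp)]
    ext k; simp only [Finset.mem_insert, Finset.mem_compl]; grind
  · intro U hU i
    have h1 := hopp U hU _ (ho U hU.le)
    have h2 := mem_opp (D := D) (v := v U) (i := o U) (j := i)
    rw [h1] at h2
    by_cases hi : i ∈ U
    · simpa [hi] using Bool.eq_not_of_ne (h2.1 hi)
    · simpa [hi] using h2
  · intro U hU i hi
    obtain ⟨h1, h2⟩ := hdown' U hU i hi
    rw [← h2, ← h1]
    simp [mul_comm, mul_left_comm, units_mul_mul_self]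

end Signed

end Design

/-! ### The sheet exhausts an atomic design; the two cases. -/

namespace Design

theorem Describes.has_iff {R C V : Type} [Fintype C] [DecidableEq C] {D : Design R C V}
    {A : Matrix R C (Entry V)} (h : D.Describes A) {r : R} {i : C} {u : V} :
    (A r i).Has u ↔ i ∈ D.supp r ∧ D.var r i = u := by
  rw [h r i]
  split_ifs with hi
  · constructor
    · rintro ⟨s, c, hs⟩
      cases hs; exact ⟨hi, rfl⟩
    · rintro ⟨-, rfl⟩
      exact ⟨_, _, rfl⟩
  · constructor
    · rintro ⟨s, c, hs⟩
      cases hs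
    · exact fun h => (hi h.1).elim

theorem Describes.has_iff_row {R C V : Type} [Fintype C] [DecidableEq C] {D : Design R C V}
    {A : Matrix R C (Entry V)} (h : D.Describes A) {r : R} {i : C} {u : V} :
    (A r i).Has u ↔ D.row u i = r := by
  rw [h.has_iff]
  constructor
  · rintro ⟨hi, rfl⟩; exact D.row_var r i hi
  · rintro rfl; exact ⟨mem_supp_row _ _, D.var_row _ _⟩

/-- Double counting of the pairs of a row and a nonzero column in it. -/
theorem card_mul_card {R C V : Type} [Fintype C] [DecidableEq C] [Fintype R] [Fintype V]
    (D : Design R C V) {w : ℕ} (hw : ∀ r, (D.supp r).card = w) :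
    Fintype.card V * Fintype.card C = Fintype.card R * w := by
  have e : V × C ≃ Σ r, D.supp r :=
    { toFun := fun x => ⟨D.row x.1 x.2, x.2, mem_supp_row _ _⟩
      invFun := fun y => (D.var y.1 y.2, y.2)
      left_inv := fun x => by simp [D.var_row]
      right_inv := by
        rintro ⟨r, i, hi⟩
        have h := D.row_var r i hi
        simp only
        congr 1
        rw [Subtype.heq_iff_coe_eq]
        simp [h] }
  have := Fintype.card_congr e
  simpa [hw] using this

namespace Sheet

variable {n m : ℕ} {R V : Type} {D : Design R (Fin n) V} (S : D.Sheet m)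

theorem row_erase {P : Finset (Fin n)} (hP : P.card = m + 1) {i : Fin n} (hi : i ∈ P) :
    D.row (S.v (P.erase i)) i = S.F P := by
  rw [S.row_v _ (by rw [Finset.card_erase_of_mem hi, hP]; rfl) i (by simp), Finset.insert_erase hi]

theorem row_insert {T : Finset (Fin n)} (hT : T.card + 1 = m) {i : Fin n} (hi : i ∉ T) :
    D.row (S.v (insert i T)) i = S.F' T := by
  rw [S.row_v' _ (by rw [Finset.card_insert_of_notMem hi, hT]) i (by simp),
    Finset.erase_insert hi]

/-- The conjugation pattern of `v U` is the indicator of `U` up to a global flip, so it determines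
`U` up to complement. -/
theorem v_eq {U U' : Finset (Fin n)} (hU : U.card = m) (hU' : U'.card = m)
    (h : S.v U = S.v U') : U' = U ∨ U' = Uᶜ := by
  have key : ∀ i, xor (S.κ U) (decide (i ∈ U)) = xor (S.κ U') (decide (i ∈ U')) := fun i => by
    rw [← S.isConj_v U hU, ← S.isConj_v U' hU', h]
  by_cases hκ : S.κ U = S.κ U'
  · left; ext i
    have := key i
    rw [hκ] at this
    simpa using this.symm
  · right; ext i
    have := key i
    rw [Finset.mem_compl]
    revert this hκ
    cases S.κ U <;> cases S.κ U' <;> by_cases h1 : i ∈ U <;> by_cases h2 : i ∈ U' <;> simp [h1, h2]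

section Atomic

variable [Fintype R] [Fintype V] {A : Matrix R (Fin n) (Entry V)}
  (hA : IsCODOn A Finset.univ) (hat : IsAtomic A) (hD : D.Describes A) (hm : 0 < m)
  (hn : n = 2 * m)

include hA hat hD hm hn

/-- Rows of the sheet contain only variables `v U`, and `v U` occurs only in rows of the sheet;
atomicity leaves no other row. -/
theorem forall_row (r : R) :
    (∃ P, P.card = m + 1 ∧ S.F P = r) ∨ (∃ T, T.card + 1 = m ∧ S.F' T = r) := by
  classical
  have := hat.eq_univ hA (Finset.univ.filter fun r =>
    (∃ P, P.card = m + 1 ∧ S.F P = r) ∨ (∃ T, T.card + 1 = m ∧ S.F' T = r))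
    (by
      obtain ⟨P, -, hP⟩ := Finset.exists_subset_card_eq (s := (Finset.univ : Finset (Fin n)))
        (n := m + 1) (by simp; omega)
      exact ⟨S.F P, by simp only [Finset.mem_filter, Finset.mem_univ, true_and]
                       exact Or.inl ⟨P, hP, rfl⟩⟩)
    (fun u => ∃ U, U.card = m ∧ S.v U = u) (by
      intro r i u hu
      rw [hD.has_iff_row] at hu
      simp only [Finset.mem_filter, Finset.mem_univ, true_and]
      constructor
      · rintro (⟨P, hP, hr⟩ | ⟨T, hT, hr⟩)
        · have hi : i ∈ P := by
            rw [← S.supp_F P hP, hr, ← hu]; exact mem_supp_row _ _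
          refine ⟨P.erase i, by rw [Finset.card_erase_of_mem hi, hP]; rfl, ?_⟩
          rw [← D.var_row (S.v (P.erase i)) i, S.row_erase hP hi, hr, ← hu, D.var_row]
        · have hi : i ∉ T := by
            rw [← Finset.mem_compl, ← S.supp_F' T hT, hr, ← hu]; exact mem_supp_row _ _
          refine ⟨insert i T, by rw [Finset.card_insert_of_notMem hi, hT], ?_⟩
          rw [← D.var_row (S.v (insert i T)) i, S.row_insert hT hi, hr, ← hu, D.var_row]
      · rintro ⟨U, hU, rfl⟩
        by_cases hi : i ∈ U
        · right
          refine ⟨U.erase i, ?_, ?_⟩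
          · rw [Finset.card_erase_add_one hi, hU]
          · rw [← hu, S.row_v' U hU i hi]
        · left
          refine ⟨insert i U, ?_, ?_⟩
          · rw [Finset.card_insert_of_notMem hi, hU]
          · rw [← hu, S.row_v U hU i hi])
  have hr : r ∈ Finset.univ := Finset.mem_univ r
  rw [← this] at hr
  simpa only [Finset.mem_filter, Finset.mem_univ, true_and] using hr

theorem forall_var (u : V) : ∃ U, U.card = m ∧ S.v U = u := by
  let i : Fin n := ⟨0, by omega⟩
  rcases S.forall_row hA hat hD hm hn (D.row u i) with ⟨P, hP, hr⟩ | ⟨T, hT, hr⟩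
  · have hi : i ∈ P := by
      rw [← S.supp_F P hP, hr]; exact mem_supp_row _ _
    refine ⟨P.erase i, by rw [Finset.card_erase_of_mem hi, hP]; rfl, ?_⟩
    rw [← D.var_row (S.v (P.erase i)) i, S.row_erase hP hi, hr, D.var_row]
  · have hi : i ∉ T := by
      rw [← Finset.mem_compl, ← S.supp_F' T hT, hr]; exact mem_supp_row _ _
    refine ⟨insert i T, by rw [Finset.card_insert_of_notMem hi, hT], ?_⟩
    rw [← D.var_row (S.v (insert i T)) i, S.row_insert hT hi, hr, D.var_row]

include S in
theorem card_supp (r : R) : (D.supp r).card = m + 1 := by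
  rcases S.forall_row hA hat hD hm hn r with ⟨P, hP, rfl⟩ | ⟨T, hT, rfl⟩
  · rw [S.supp_F P hP, hP]
  · rw [S.supp_F' T hT, Finset.card_compl, Fintype.card_fin]; omega

end Atomic

/-- Either the rows `F P` and `F' Pᶜ` agree for all `P`, or for none. -/
theorem F_eq_F'_compl (hn : n = 2 * m) {P₀ : Finset (Fin n)} (hP₀ : P₀.card = m + 1)
    (h₀ : S.F P₀ = S.F' P₀ᶜ) {P : Finset (Fin n)} (hP : P.card = m + 1) : S.F P = S.F' Pᶜ := by
  refine exchange_induction (Q := fun P => S.F P = S.F' Pᶜ) h₀ ?_ P (hP.trans hP₀.symm)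
  intro P i j hP hi hj h
  rw [hP₀] at hP
  have hPc : Pᶜ.card + 1 = m := by
    have := P.card_le_univ
    rw [Fintype.card_fin] at this
    rw [Finset.card_compl, Fintype.card_fin]; omega
  have hij : i ≠ j := by rintro rfl; exact hj hi
  -- A coincidence over `P` identifies the variables of two complementary `m`-sets. Following this
  -- variable to column `j` gives the coincidence over the exchanged set.
  have hv : S.v (P.erase i) = S.v (insert i Pᶜ) := by
    rw [← D.var_row (S.v (P.erase i)) i, S.row_erase hP hi, h,
      ← S.row_insert hPc (i := i) (by simpa using hi), D.var_row]
  have hc : (insert j (P.erase i))ᶜ = (insert i Pᶜ).erase j := by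
    ext k; simp only [Finset.mem_compl, Finset.mem_insert, Finset.mem_erase]; grind
  rw [hc, ← S.row_v _ (by rw [Finset.card_erase_of_mem hi, hP]; rfl) j (by simp [hj]), hv,
    S.row_v' _ (by rw [Finset.card_insert_of_notMem (by simpa using hi), hPc]) j (by simp [hj])]

theorem F_injOn {P P' : Finset (Fin n)} (hP : P.card = m + 1) (hP' : P'.card = m + 1)
    (h : S.F P = S.F P') : P = P' := by
  rw [← S.supp_F P hP, h, S.supp_F P' hP']

theorem F'_injOn {T T' : Finset (Fin n)} (hT : T.card + 1 = m) (hT' : T'.card + 1 = m)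
    (h : S.F' T = S.F' T') : T = T' := by
  rw [← compl_inj_iff, ← S.supp_F' T hT, h, S.supp_F' T' hT']

section Signs

variable (hn : n = 2 * m) (hF : ∀ P : Finset (Fin n), P.card = m + 1 → S.F P = S.F' Pᶜ)

include hn hF

/-- The entry in column `i` of the common row has two sign formulas, from `P.erase i` and from its
complement; `posSign_compl` accounts for `(-1) ^ i`. -/
theorem g_mul_g' {P : Finset (Fin n)} (hP : P.card = m + 1) {i : Fin n} (hi : i ∈ P) :
    S.g P * S.g' Pᶜ = (-1) ^ (i : ℕ) * (S.gv (P.erase i) * S.gv (P.erase i)ᶜ) := by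
  have hPc : Pᶜ.card + 1 = m := by
    have := P.card_le_univ
    rw [Fintype.card_fin] at this
    rw [Finset.card_compl, Fintype.card_fin]; omega
  have h1 := S.sgn_F (P.erase i) (by rw [Finset.card_erase_of_mem hi, hP]; rfl) i (by simp)
  have hc : (P.erase i)ᶜ = insert i Pᶜ := by
    ext k; simp only [Finset.mem_compl, Finset.mem_insert, Finset.mem_erase]; grind
  have hic : i ∉ Pᶜ := by simpa using hi
  have h2 := S.sgn_F' (insert i Pᶜ) (by rw [Finset.card_insert_of_notMem hic, hPc]) i (by simp)
  rw [Finset.erase_insert hic, ← hF P hP, posSign_insert] at h2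
  rw [Finset.insert_erase hi, h2, posSign_erase] at h1
  rw [posSign_compl] at h1
  have h4 : S.g' Pᶜ = S.g P * S.gv (P.erase i) * S.gv (insert i Pᶜ) * (-1) ^ (i : ℕ) := by
    calc S.g' Pᶜ = S.g' Pᶜ * S.gv (insert i Pᶜ) * ((-1) ^ (i : ℕ) * posSign P i) *
          (S.gv (insert i Pᶜ) * ((-1) ^ (i : ℕ) * posSign P i)) := by
            rw [mul_assoc (S.g' Pᶜ), mul_assoc (S.g' Pᶜ), Int.units_mul_self, mul_one]
      _ = _ := by
            rw [h1]
            simp [mul_comm, mul_left_comm, mul_assoc, units_mul_mul_self]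
  rw [hc, h4]
  simp [mul_comm, mul_left_comm, mul_assoc, units_mul_mul_self]

/-- Sets related by an exchange `i → j` share `U = P.erase i`, so by `g_mul_g'` their products
differ by `(-1) ^ (i + j)`. -/
theorem exists_const : ∃ c : ℤˣ, ∀ P : Finset (Fin n), P.card = m + 1 →
    S.g P * S.g' Pᶜ = c * ∏ i ∈ P, (-1) ^ (i : ℕ) := by
  by_cases hex : ∃ P₀ : Finset (Fin n), P₀.card = m + 1
  · obtain ⟨P₀, hP₀⟩ := hex
    refine ⟨S.g P₀ * S.g' P₀ᶜ * ∏ i ∈ P₀, (-1) ^ (i : ℕ), fun P hP => ?_⟩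
    refine exchange_induction (P₀ := P₀) (Q := fun P => S.g P * S.g' Pᶜ =
      (S.g P₀ * S.g' P₀ᶜ * ∏ i ∈ P₀, (-1) ^ (i : ℕ)) * ∏ i ∈ P, (-1) ^ (i : ℕ)) ?_ ?_ P
      (hP.trans hP₀.symm)
    · rw [mul_assoc, Int.units_mul_self, mul_one]
    · intro P i j hP hi hj h
      rw [hP₀] at hP
      have h1 := S.g_mul_g' hn hF hP hi
      have h2 := S.g_mul_g' hn hF (P := insert j (P.erase i))
        (by rw [card_exchange hi hj, hP]) (i := j) (by simp)
      rw [Finset.erase_insert (by simp [hj])] at h2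
      rw [Finset.prod_insert (by simp [hj]), h2]
      rw [h1, ← Finset.mul_prod_erase P _ hi] at h
      generalize (S.g P₀ * S.g' P₀ᶜ * ∏ i ∈ P₀, (-1 : ℤˣ) ^ (i : ℕ)) = c at *
      rw [mul_left_comm c] at h
      rw [mul_left_cancel h, mul_left_comm c]
  · push Not at hex
    exact ⟨1, fun P hP => (hex P hP).elim⟩

/-- The product `gv U * gv Uᶜ` is symmetric under complement and equals `c * ∏ i ∈ U, (-1) ^ i`. So
the product of `(-1) ^ i` over all columns is `1`; its exponent is `m * (2 * m - 1)`. -/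
theorem even (hm : 0 < m) : Even m := by
  obtain ⟨c, hc⟩ := S.exists_const hn hF
  have key : ∀ U : Finset (Fin n), U.card = m →
      S.gv U * S.gv Uᶜ = c * ∏ i ∈ U, (-1) ^ (i : ℕ) := by
    intro U hU
    obtain ⟨i, hi⟩ : ∃ i, i ∉ U := by
      by_contra! hcon
      have := Finset.card_eq_of_equiv_fin (Equiv.subtypeUnivEquiv hcon)
      omega
    have hP : (insert i U).card = m + 1 := by rw [Finset.card_insert_of_notMem hi, hU]
    have h1 := S.g_mul_g' hn hF hP (i := i) (by simp)
    rw [Finset.erase_insert hi, hc _ hP, Finset.prod_insert hi, mul_left_comm] at h1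
    exact (mul_left_cancel h1).symm
  obtain ⟨U, -, hU⟩ := Finset.exists_subset_card_eq (s := (Finset.univ : Finset (Fin n)))
    (n := m) (by simp; omega)
  have h1 := key U hU
  have h2 := key Uᶜ (by rw [Finset.card_compl, Fintype.card_fin]; omega)
  rw [compl_compl, mul_comm, h1] at h2
  have h3 := mul_left_cancel h2
  have h4 : ∏ i : Fin n, (-1 : ℤˣ) ^ (i : ℕ) = 1 := by
    rw [← Finset.prod_mul_prod_compl U, h3, Int.units_mul_self]
  rw [Finset.prod_pow_eq_pow_sum, Fin.sum_univ_eq_sum_range (fun i => i)] at h4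
  have h5 := Finset.sum_range_id_mul_two n
  have h6 : Even (∑ i ∈ Finset.range n, i) := by
    by_contra hodd
    rw [Nat.not_even_iff_odd] at hodd
    rw [hodd.neg_one_pow] at h4
    exact absurd h4 (by decide)
  have h7 : ∑ i ∈ Finset.range n, i = m * (2 * m - 1) := by
    rw [hn] at h5 ⊢
    have : (∑ i ∈ Finset.range (2 * m), i) * 2 = (m * (2 * m - 1)) * 2 := by rw [h5]; ring
    omega
  rw [h7, Nat.even_mul] at h6
  rcases h6 with h6 | h6
  · exact h6
  · obtain ⟨a, ha⟩ := h6; omega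

end Signs

end Sheet

end Design

/-! ### The entries of `𝒢` and `ℋ` in terms of sets. -/

section Vec

variable {N : ℕ}

/-- The indicator vector of a set of positions. -/
def ind (S : Finset (Fin N)) : Vec N := fun t => if t ∈ S then 1 else 0

/-- The set of the positions of the ones. -/
def ones (α : Vec N) : Finset (Fin N) := Finset.univ.filter fun t => α t = 1

theorem zmod_two_eq (x : ZMod 2) : x = 0 ∨ x = 1 := by revert x; decide

theorem mem_ones {α : Vec N} {t : Fin N} : t ∈ ones α ↔ α t = 1 := by simp [ones]

theorem ind_apply_eq_one {S : Finset (Fin N)} {t : Fin N} : ind S t = 1 ↔ t ∈ S := by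
  simp [ind]

theorem ind_apply_eq_zero {S : Finset (Fin N)} {t : Fin N} : ind S t = 0 ↔ t ∉ S := by
  simp [ind]

theorem ones_ind (S : Finset (Fin N)) : ones (ind S) = S := by
  ext t; rw [mem_ones, ind_apply_eq_one]

theorem ind_ones (α : Vec N) : ind (ones α) = α := by
  ext t
  rcases zmod_two_eq (α t) with h | h <;> simp [ind, mem_ones, h]

theorem ind_injective : Function.Injective (ind (N := N)) :=
  Function.LeftInverse.injective ones_ind

theorem ind_val (S : Finset (Fin N)) (t : Fin N) : (ind S t).val = if t ∈ S then 1 else 0 := by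
  unfold ind; split_ifs <;> rfl

theorem wt_ind (S : Finset (Fin N)) : wt (ind S) = S.card := by
  simp [wt, ind_val]

theorem wtFrom_ind (S : Finset (Fin N)) (i : Fin N) :
    wtFrom i (ind S) = (S.filter fun t => i ≤ t).card := by
  simp only [wtFrom, ind_val]
  rw [← Finset.card_filter, Finset.filter_filter]
  congr 1
  ext t; simp [and_comm]

/-- Bits of even number sit at odd indices, as indices start at `0`. -/
theorem psi_ind (S : Finset (Fin N)) : (-1 : ℤˣ) ^ psi (ind S) = ∏ i ∈ S, (-1) ^ (i : ℕ) := by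
  rw [psi, Finset.sum_filter, ← Finset.prod_pow_eq_pow_sum]
  rw [← Finset.prod_subset (Finset.subset_univ S)]
  · refine Finset.prod_congr rfl fun i hi => ?_
    rw [ind_val, if_pos hi]
    rcases Nat.even_or_odd (i : ℕ) with h | h
    · rw [if_neg (by rw [Nat.even_add_one]; exact not_not.2 h), h.neg_one_pow, pow_zero]
    · rw [if_pos (by rw [Nat.even_add_one, Nat.not_even_iff_odd]; exact h), h.neg_one_pow, pow_one]
  · intro i _ hi
    simp [ind_val, hi]

theorem neg_one_pow_wtFrom (S : Finset (Fin N)) (i : Fin N) :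
    (-1 : ℤˣ) ^ wtFrom i (ind S) = (-1) ^ S.card * posSign S i := by
  have h := Finset.card_filter_add_card_filter_not (s := S) (· < i)
  rw [Finset.filter_congr (q := fun t => i ≤ t) fun t _ => not_lt] at h
  rw [wtFrom_ind, ← h, pow_add, posSign]
  rw [mul_right_comm, Int.units_mul_self, one_mul]

/-- The sign `(-1) ^ ⌊i / 2⌋` of the column number `i`. -/
def colSign (i : ℕ) : ℤˣ := (-1) ^ ((i + 1) / 2)

variable {l : ℕ}

theorem bigG_zero {S : Finset (Fin (l + 1))} {i : Fin l} (hi : i.castSucc ∉ S) :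
    bigG l (ind S) i = .zero := by
  simp [bigG, ind_apply_eq_zero.2 hi]

theorem bigG_of_last_notMem {S : Finset (Fin (l + 1))} {i : Fin l} (hi : i.castSucc ∈ S)
    (hl : Fin.last l ∉ S) : bigG l (ind S) i =
      .lit ((-1) ^ S.card * posSign S i.castSucc * colSign i) false
        (ind (S.erase i.castSucc)) := by
  have h1 : ind S i.castSucc ≠ 0 := by rw [ind_apply_eq_one.2 hi]; decide
  have h2 := ind_apply_eq_zero.2 hl
  simp only [bigG, Matrix.of_apply, if_neg h1, h2]
  congr 1
  · rw [← neg_one_pow_wtFrom, theta, h2]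
    split_ifs with he
    · rw [pow_add, colSign]
    · have : ((i : ℕ) + 1) / 2 = i / 2 := by rw [Nat.even_iff] at he; omega
      rw [colSign, this]; simp [pow_add]
  · ext t
    by_cases ht : t = i.castSucc
    · subst ht
      simp only [phi, h2, zero_smul, add_zero, Pi.add_apply, ind_apply_eq_one.2 hi, Pi.single_eq_same]
      rw [ind_apply_eq_zero.2 (by simp)]; decide
    · simp only [phi, h2, zero_smul, add_zero, Pi.add_apply, Pi.single_eq_of_ne ht]
      simp only [ind, Finset.mem_erase, ne_eq, ht, not_false_eq_true, true_and]

/-- Here `phi` complements, so the sign is expressed through `Sᶜ`. The parity-dependent term in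
`theta` is what absorbs the `(-1) ^ i` of `posSign_compl`. -/
theorem bigG_of_last_mem {S : Finset (Fin (l + 1))} {i : Fin l} (hi : i.castSucc ∈ S)
    (hl : Fin.last l ∈ S) : bigG l (ind S) i =
      .lit (-(-1) ^ S.card * posSign Sᶜ i.castSucc * colSign i) true
        (ind (insert i.castSucc Sᶜ)) := by
  have h1 : ind S i.castSucc ≠ 0 := by rw [ind_apply_eq_one.2 hi]; decide
  have h2 := ind_apply_eq_one.2 hl
  simp only [bigG, Matrix.of_apply, if_neg h1, h2]
  congr 1
  · rw [posSign_compl, theta, h2]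
    split_ifs with he
    · rw [pow_add, colSign, neg_one_pow_wtFrom]
      have : Odd (i : ℕ) := by rw [Nat.even_add_one, Nat.not_even_iff_odd] at he; exact he
      simp [this.neg_one_pow]
    · have h3 : ((i : ℕ) + 1) / 2 = i / 2 := by rw [Nat.even_iff] at he; omega
      have : Even (i : ℕ) := by rw [Nat.even_add_one, not_not] at he; exact he
      rw [colSign, h3, pow_add, pow_add, neg_one_pow_wtFrom]
      simp [this.neg_one_pow, ZMod.val_one]
  · ext t
    by_cases ht : t = i.castSucc
    · subst ht
      simp only [phi, h2, one_smul, Pi.add_apply, ind_apply_eq_one.2 hi, Pi.single_eq_same,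
        Pi.one_apply]
      rw [ind_apply_eq_one.2 (by simp)]; decide
    · simp only [phi, h2, one_smul, Pi.add_apply, Pi.single_eq_of_ne ht, Pi.one_apply]
      by_cases hS : t ∈ S
      · rw [ind_apply_eq_one.2 hS, ind_apply_eq_zero.2 (by simp [ht, hS])]; decide
      · rw [ind_apply_eq_zero.2 hS, ind_apply_eq_one.2 (by simp [hS])]; decide

theorem bigH_castSucc (α : Vec (l + 1)) (i : Fin l) : bigH l α i.castSucc = bigG l α i := by
  simp [bigH]

theorem bigH_last_zero {S : Finset (Fin (l + 1))} (hl : Fin.last l ∉ S) :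
    bigH l (ind S) (Fin.last l) = .zero := by
  simp [bigH, colL, ind_apply_eq_zero.2 hl]

theorem bigH_last {S : Finset (Fin (l + 1))} (hl : Fin.last l ∈ S) :
    bigH l (ind S) (Fin.last l) =
      .lit (∏ i ∈ S, (-1) ^ (i : ℕ)) false (ind (S.erase (Fin.last l))) := by
  have h2 := ind_apply_eq_one.2 hl
  have h3 : ind S + Pi.single (Fin.last l) 1 = ind (S.erase (Fin.last l)) := by
    ext t
    by_cases ht : t = Fin.last l
    · subst ht; simp [ind, hl]; decide
    · simp [ind, ht]
  simp [bigH, colL, h2, psi_ind, h3]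

end Vec

theorem Equivalent.of_equiv {R R' C V V' : Type} {A : Matrix R C (Entry V)}
    {B : Matrix R' C (Entry V')} (e : R' ≃ R) (τ : V → V') (ε : V → ℤˣ) (κ : V → Bool)
    (M : R' → ℤˣ) (ν : C → ℤˣ) (hτ : Function.Injective τ)
    (h : ∀ r i, B r i = (A (e r) i).transform (M r * ν i) τ ε κ) : Equivalent A B :=
  ⟨e.symm, Equiv.refl C, τ, ε, κ, fun r => M (e.symm r), ν, hτ.injOn, fun r i => by
    simpa using h (e.symm r) i⟩

/-! ### Equivalence with the normal forms. -/

namespace Design.Sheet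

variable {n m : ℕ} {R V : Type} {D : Design R (Fin n) V} (S : D.Sheet m)

/-- Conjugating by `κ` and negating by `gv` normalizes the variables: `v U` becomes conjugated
exactly in the columns of `U`. -/
theorem transform_eq {V' : Type} {A : Matrix R (Fin n) (Entry V)} (hD : D.Describes A)
    {rep : V → Finset (Fin n)} (f : Finset (Fin n) → V') {U : Finset (Fin n)} (hU : U.card = m)
    (hrep : rep (S.v U) = U) {r : R} {i : Fin n} (hr : D.row (S.v U) i = r) (s : ℤˣ) :
    (A r i).transform s (fun u => f (rep u)) (fun u => S.gv (rep u)) (fun u => S.κ (rep u)) =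
      .lit (s * S.gv U * D.sgn r i) (decide (i ∈ U)) (f U) := by
  have h1 : i ∈ D.supp r := by rw [← hr]; exact mem_supp_row _ _
  have h2 : D.var r i = S.v U := by rw [← hr, D.var_row]
  rw [hD r i, if_pos h1, h2, Entry.transform, hrep, S.isConj_v U hU]
  simp

theorem transform_zero {V' : Type} {A : Matrix R (Fin n) (Entry V)} (hD : D.Describes A)
    {r : R} {i : Fin n} (hr : i ∉ D.supp r) (s : ℤˣ) (τ : V → V') (ε : V → ℤˣ) (κ : V → Bool) :
    (A r i).transform s τ ε κ = .zero := by
  rw [hD r i, if_neg hr, Entry.transform]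

theorem exists_notMem (hm : 0 < m) (hn : n = 2 * m) {U : Finset (Fin n)} (hU : U.card = m) :
    ∃ i, i ∉ U := by
  by_contra! hcon
  have := Finset.card_eq_of_equiv_fin (Equiv.subtypeUnivEquiv hcon)
  omega

theorem v_compl_iff (hn : n = 2 * m) {U : Finset (Fin n)} (hU : U.card = m) {i : Fin n}
    (hi : i ∉ U) : S.v Uᶜ = S.v U ↔ S.F (insert i U) = S.F' (insert i U)ᶜ := by
  have h1 := S.row_v U hU i hi
  have h2 := S.row_v' Uᶜ (by rw [Finset.card_compl, Fintype.card_fin]; omega) i (by simpa using hi)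
  rw [Finset.compl_insert, ← h1, ← h2]
  constructor
  · intro h; rw [h]
  · intro h; rw [← D.var_row (S.v U) i, h, D.var_row]

section Single

variable {l : ℕ} {D : Design R (Fin (l + 1)) V} (S : D.Sheet m)
  {A : Matrix R (Fin (l + 1)) (Entry V)}

/-- Here `v U = v Uᶜ`. Naming each variable by the set that avoids the last column leaves it
unconjugated there, as in `ℒ`. -/
theorem equivalent_bigH (hD : D.Describes A) (hm : 0 < m) (hn : l + 1 = 2 * m)
    (hF : ∀ P : Finset (Fin (l + 1)), P.card = m + 1 → S.F P = S.F' Pᶜ)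
    (hsurj : ∀ r, ∃ P : Finset (Fin (l + 1)), P.card = m + 1 ∧ S.F P = r)
    (hvar : ∀ u, ∃ U : Finset (Fin (l + 1)), U.card = m ∧ S.v U = u) :
    Equivalent A ((bigH l).submatrix (Subtype.val : {α : Vec (l + 1) // wt α = m + 1} → _) id) := by
  have hrep : ∀ u, ∃ U : Finset (Fin (l + 1)), U.card = m ∧ Fin.last l ∉ U ∧ S.v U = u := by
    intro u
    obtain ⟨U, hU, hu⟩ := hvar u
    by_cases hl : Fin.last l ∈ U
    · obtain ⟨i, hi⟩ := exists_notMem hm hn hU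
      refine ⟨Uᶜ, by rw [Finset.card_compl, Fintype.card_fin]; omega, by simpa using hl, ?_⟩
      rw [← hu, S.v_compl_iff hn hU hi]
      exact hF _ (by rw [Finset.card_insert_of_notMem hi, hU])
    · exact ⟨U, hU, hl, hu⟩
  choose rep rep_card rep_last rep_v using hrep
  have rep_eq : ∀ U : Finset (Fin (l + 1)), U.card = m → Fin.last l ∉ U → rep (S.v U) = U := by
    intro U hU hl
    rcases S.v_eq hU (rep_card _) (rep_v (S.v U)).symm with h | h
    · exact h
    · have := rep_last (S.v U)
      rw [h] at this
      exact (this (by simpa using hl)).elim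
  obtain ⟨c, hc⟩ := S.exists_const hn hF
  have hones : ∀ α : Vec (l + 1), wt α = m + 1 → (ones α).card = m + 1 := by
    intro α hα
    rw [← hα, ← wt_ind, ind_ones]
  let e : {α : Vec (l + 1) // wt α = m + 1} ≃ R :=
    Equiv.ofBijective (fun α => S.F (ones α.1)) ⟨by
      rintro ⟨α, hα⟩ ⟨β, hβ⟩ h
      have := S.F_injOn (hones α hα) (hones β hβ) h
      refine Subtype.ext ?_
      change α = β
      rw [← ind_ones α, this, ind_ones], by
      intro r
      obtain ⟨P, hP, hr⟩ := hsurj r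
      exact ⟨⟨ind P, by rw [wt_ind, hP]⟩, by simpa only [ones_ind] using hr⟩⟩
  refine Equivalent.of_equiv e (fun u => ind (rep u)) (fun u => S.gv (rep u))
    (fun u => S.κ (rep u))
    -- In a row with a nonzero last entry, the other columns are named by complements and so are
    -- governed by `g'`. Only the last column involves `g`, which `exists_const` converts to `g'` at
    -- the cost of `c` and the sign of `ℒ`.
    (fun α => if Fin.last l ∈ ones α.1 then -(-1) ^ (m + 1) * S.g' (ones α.1)ᶜ
      else (-1) ^ (m + 1) * S.g (ones α.1))
    (fun i => if i = Fin.last l then c else colSign i) ?_ ?_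
  · intro u u' h
    rw [← rep_v u, ind_injective h, rep_v]
  rintro ⟨α, hα⟩ i
  obtain ⟨P, rfl⟩ : ∃ P, α = ind P := ⟨ones α, (ind_ones α).symm⟩
  have hP : P.card = m + 1 := by rw [← wt_ind, hα]
  have he : e ⟨ind P, hα⟩ = S.F P := by
    change S.F (ones (ind P)) = S.F P
    rw [ones_ind]
  rw [he]
  simp only [ones_ind, Matrix.submatrix_apply, id]
  by_cases hi : i ∈ P
  swap
  · rw [transform_zero hD (by rwa [S.supp_F P hP])]
    induction i using Fin.lastCases with
    | last => exact bigH_last_zero hi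
    | cast i => rw [bigH_castSucc]; exact bigG_zero hi
  have hcard : (P.erase i).card = m := by rw [Finset.card_erase_of_mem hi, hP]; rfl
  have up : ∀ s, Fin.last l ∉ P.erase i →
      (A (S.F P) i).transform s (fun u => ind (rep u)) (fun u => S.gv (rep u))
      (fun u => S.κ (rep u)) = .lit (s * S.g P * posSign P i) false (ind (P.erase i)) := by
    intro s hl
    rw [S.transform_eq hD ind hcard (rep_eq _ hcard hl) (S.row_erase hP hi)]
    have := S.sgn_F _ hcard i (by simp)
    rw [Finset.insert_erase hi] at this
    rw [this, posSign_erase]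
    simp [mul_comm, mul_left_comm]
  induction i using Fin.lastCases with
  | last =>
    rw [up _ (by simp), bigH_last hi, if_pos hi, if_pos rfl]
    congr 1
    have h1 : posSign P (Fin.last l) = (-1) ^ m := by
      rw [← posSign_erase, posSign, Finset.filter_true_of_mem, hcard]
      intro j hj
      exact Fin.lt_last_iff_ne_last.2 (Finset.ne_of_mem_erase hj)
    have h2 : S.g P = c * (∏ i ∈ P, (-1) ^ (i : ℕ)) * S.g' Pᶜ := by
      rw [← hc P hP, mul_assoc, Int.units_mul_self, mul_one]
    rw [h1, h2, pow_succ]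
    simp [mul_comm, mul_left_comm, mul_assoc, units_mul_mul_self]
  | cast i =>
    rw [bigH_castSucc, if_neg (Fin.castSucc_ne_last i)]
    by_cases hl : Fin.last l ∈ P
    · have hic : i.castSucc ∉ Pᶜ := by simpa using hi
      have hPc : Pᶜ.card + 1 = m := by rw [Finset.card_compl, Fintype.card_fin]; omega
      have hcard' : (insert i.castSucc Pᶜ).card = m := by
        rw [Finset.card_insert_of_notMem hic, hPc]
      have hl' : Fin.last l ∉ insert i.castSucc Pᶜ := by
        simp [hl, (Fin.castSucc_ne_last i).symm]
      rw [S.transform_eq hD ind hcard' (rep_eq _ hcard' hl')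
        (by rw [S.row_insert hPc hic, hF P hP]), bigG_of_last_mem hi hl, if_pos hl]
      have := S.sgn_F' _ hcard' i.castSucc (by simp)
      rw [Finset.erase_insert hic, ← hF P hP, posSign_insert] at this
      rw [this, hP]
      congr 1
      · simp [mul_comm, mul_left_comm, mul_assoc]
      · simp
    · rw [up _ (by simp [hl]), bigG_of_last_notMem hi hl, if_neg hl, hP]
      congr 1
      simp [mul_comm, mul_left_comm, Int.units_mul_self]

end Single

section Lift

variable {l : ℕ}

/-- A set of positions as a set of positions in a longer vector. -/
def lift (P : Finset (Fin l)) : Finset (Fin (l + 1)) := P.map Fin.castSuccEmb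

theorem castSucc_mem_lift {P : Finset (Fin l)} {i : Fin l} : i.castSucc ∈ lift P ↔ i ∈ P := by
  simp [lift]

theorem last_notMem_lift (P : Finset (Fin l)) : Fin.last l ∉ lift P := by
  simp [lift, Fin.castSucc_ne_last]

theorem card_lift (P : Finset (Fin l)) : (lift P).card = P.card := Finset.card_map _

theorem lift_injective : Function.Injective (lift (l := l)) := Finset.map_injective _

theorem lift_erase (P : Finset (Fin l)) (i : Fin l) : (lift P).erase i.castSucc = lift (P.erase i) :=
  (Finset.map_erase Fin.castSuccEmb P i).symm

theorem lift_insert (P : Finset (Fin l)) (i : Fin l) :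
    insert i.castSucc (lift P) = lift (insert i P) :=
  (Finset.map_insert Fin.castSuccEmb i P).symm

theorem posSign_lift (P : Finset (Fin l)) (i : Fin l) :
    posSign (lift P) i.castSucc = posSign P i := by
  rw [posSign, posSign, lift, Finset.filter_map, Finset.card_map]
  congr 2

theorem exists_lift {Q : Finset (Fin (l + 1))} (hQ : Fin.last l ∉ Q) : ∃ P, Q = lift P := by
  refine ⟨Finset.univ.filter fun i => i.castSucc ∈ Q, ?_⟩
  ext t
  induction t using Fin.lastCases with
  | last => simp [hQ, last_notMem_lift]
  | cast t => simp [castSucc_mem_lift]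

end Lift

section Double

variable {A : Matrix R (Fin n) (Entry V)}

/-- Here `v` is injective on `m`-sets, so each variable has a unique name `U`. Last bit `0` indexes
the rows `F P`, last bit `1` the rows `F' Pᶜ`. -/
theorem equivalent_subG (hD : D.Describes A) (hm : 0 < m) (hn : n = 2 * m)
    (hF : ∀ P : Finset (Fin n), P.card = m + 1 → S.F P ≠ S.F' Pᶜ)
    (hsurj : ∀ r, (∃ P, P.card = m + 1 ∧ S.F P = r) ∨ (∃ T, T.card + 1 = m ∧ S.F' T = r))
    (hvar : ∀ u, ∃ U : Finset (Fin n), U.card = m ∧ S.v U = u) :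
    Equivalent A (subG n m) := by
  choose rep rep_card rep_v using hvar
  have rep_eq : ∀ U : Finset (Fin n), U.card = m → rep (S.v U) = U := by
    intro U hU
    rcases S.v_eq hU (rep_card _) (rep_v (S.v U)).symm with h | h
    · exact h
    · obtain ⟨i, hi⟩ := exists_notMem hm hn hU
      have h1 := (S.v_compl_iff hn hU hi).1 (by rw [← h, rep_v])
      exact (hF _ (by rw [Finset.card_insert_of_notMem hi, hU]) h1).elim
  have card_compl : ∀ P : Finset (Fin n), P.card = m + 1 ↔ Pᶜ.card + 1 = m := by
    intro P
    have := P.card_le_univ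
    rw [Fintype.card_fin] at this
    rw [Finset.card_compl, Fintype.card_fin]; omega
  -- The complement of an `(m - 1)`-set in `n + 1` positions has `m + 2` elements, and `m + 2 + m =
  -- n + 2`.
  have hidx : ∀ α : Vec (n + 1), ((α (Fin.last n) = 0 ∧ wt α = m + 1) ∨
      (α (Fin.last n) = 1 ∧ wt α + m = n + 2)) ↔
      ∃ P : Finset (Fin n), P.card = m + 1 ∧ (α = ind (lift P) ∨ α = ind (lift Pᶜ)ᶜ) := by
    intro α
    constructor
    · rintro (⟨h0, h1⟩ | ⟨h0, h1⟩)
      · obtain ⟨P, hP⟩ := exists_lift (Q := ones α) (by rw [mem_ones, h0]; decide)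
        refine ⟨P, ?_, Or.inl (by rw [← hP, ind_ones])⟩
        rw [← card_lift, ← hP, ← h1, ← wt_ind, ind_ones]
      · obtain ⟨T, hT⟩ := exists_lift (Q := (ones α)ᶜ) (by simp [mem_ones, h0])
        refine ⟨Tᶜ, ?_, Or.inr (by rw [compl_compl, ← hT, compl_compl, ind_ones])⟩
        rw [card_compl, compl_compl, ← card_lift, ← hT, Finset.card_compl, ← wt_ind, ind_ones,
          Fintype.card_fin]
        omega
    · rintro ⟨P, hP, rfl | rfl⟩
      · left
        rw [ind_apply_eq_zero, wt_ind, card_lift]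
        exact ⟨last_notMem_lift P, hP⟩
      · right
        have := (card_compl P).1 hP
        rw [ind_apply_eq_one, Finset.mem_compl, wt_ind, Finset.card_compl, Fintype.card_fin,
          card_lift]
        exact ⟨last_notMem_lift _, by omega⟩
  have hne : ∀ P Q : Finset (Fin n), ind (lift P) ≠ ind (lift Q)ᶜ := by
    intro P Q h
    have h1 := last_notMem_lift P
    rw [ind_injective h] at h1
    exact h1 (by simpa using last_notMem_lift Q)
  let base : Vec (n + 1) → Finset (Fin n) := fun α =>
    Finset.univ.filter fun i => i.castSucc ∈ ones α
  have base_up : ∀ P, base (ind (lift P)) = P := by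
    intro P; ext i; simp [base, ones_ind, castSucc_mem_lift]
  have base_down : ∀ P, base (ind (lift Pᶜ)ᶜ) = P := by
    intro P; ext i; simp [base, ones_ind, castSucc_mem_lift]
  let row : Vec (n + 1) → R := fun α =>
    if α (Fin.last n) = 0 then S.F (base α) else S.F' (base α)ᶜ
  have zero_up : ∀ P : Finset (Fin n), ind (lift P) (Fin.last n) = 0 := fun P =>
    ind_apply_eq_zero.2 (last_notMem_lift P)
  have zero_down : ∀ P : Finset (Fin n), ind (lift P)ᶜ (Fin.last n) ≠ 0 := fun P => by
    rw [ind_apply_eq_one.2 (by simpa using last_notMem_lift P)]; decide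
  have row_up : ∀ P, row (ind (lift P)) = S.F P := fun P => by
    simp only [row, if_pos (zero_up P), base_up]
  have row_down : ∀ P, row (ind (lift Pᶜ)ᶜ) = S.F' Pᶜ := fun P => by
    simp only [row, if_neg (zero_down _), base_down]
  have hFF : ∀ P Q : Finset (Fin n), P.card = m + 1 → Q.card = m + 1 → S.F P ≠ S.F' Qᶜ := by
    intro P Q hP hQ h
    have h1 := S.supp_F P hP
    rw [h, S.supp_F' _ ((card_compl Q).1 hQ), compl_compl] at h1
    exact hF P hP (by rw [h, h1])
  let e : {α : Vec (n + 1) // (α (Fin.last n) = 0 ∧ wt α = m + 1) ∨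
      (α (Fin.last n) = 1 ∧ wt α + m = n + 2)} ≃ R :=
    Equiv.ofBijective (fun α => row α.1) ⟨by
      rintro ⟨α, hα⟩ ⟨β, hβ⟩ h
      ext1
      dsimp only at h ⊢
      obtain ⟨P, hP, rfl | rfl⟩ := (hidx α).1 hα <;> obtain ⟨Q, hQ, rfl | rfl⟩ := (hidx β).1 hβ
      · rw [row_up, row_up] at h
        rw [S.F_injOn hP hQ h]
      · rw [row_up, row_down] at h
        exact (hFF P Q hP hQ h).elim
      · rw [row_up, row_down] at h
        exact (hFF Q P hQ hP h.symm).elim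
      · rw [row_down, row_down] at h
        rw [S.F'_injOn ((card_compl P).1 hP) ((card_compl Q).1 hQ) h], by
      intro r
      rcases hsurj r with ⟨P, hP, hr⟩ | ⟨T, hT, hr⟩
      · exact ⟨⟨_, (hidx _).2 ⟨P, hP, Or.inl rfl⟩⟩, (row_up P).trans hr⟩
      · refine ⟨⟨_, (hidx _).2 ⟨Tᶜ, ?_, Or.inr rfl⟩⟩, (row_down Tᶜ).trans ?_⟩
        · rw [card_compl, compl_compl, hT]
        · rw [compl_compl, hr]⟩
  refine Equivalent.of_equiv e (fun u => ind (lift (rep u))) (fun u => S.gv (rep u))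
    (fun u => S.κ (rep u))
    (fun α => (-1) ^ (m + 1) *
      if α.1 (Fin.last n) = 0 then S.g (base α.1) else S.g' (base α.1)ᶜ)
    (fun i => colSign i) ?_ ?_
  · intro u u' h
    rw [← rep_v u, lift_injective (ind_injective h), rep_v]
  rintro ⟨α, hα⟩ i
  change bigG n α i = (A (row α) i).transform _ _ _ _
  obtain ⟨P, hP, rfl | rfl⟩ := (hidx α).1 hα
  · rw [row_up]
    simp only [if_pos (zero_up P), base_up]
    by_cases hi : i ∈ P
    · have hcard : (P.erase i).card = m := by rw [Finset.card_erase_of_mem hi, hP]; rfl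
      rw [S.transform_eq hD (fun U => ind (lift U)) hcard (rep_eq _ hcard) (S.row_erase hP hi),
        bigG_of_last_notMem (castSucc_mem_lift.2 hi) (last_notMem_lift P), lift_erase,
        posSign_lift, card_lift, hP]
      have := S.sgn_F _ hcard i (by simp)
      rw [Finset.insert_erase hi] at this
      rw [this, posSign_erase]
      congr 1
      · simp [mul_comm, mul_left_comm, mul_assoc, Int.units_mul_self]
      · simp
    · rw [transform_zero hD (by rwa [S.supp_F P hP]), bigG_zero]
      rwa [castSucc_mem_lift]
  · rw [row_down]
    have hPc := (card_compl P).1 hP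
    simp only [if_neg (zero_down _), base_down]
    by_cases hi : i ∈ P
    · have hic : i ∉ Pᶜ := by simpa using hi
      have hcard : (insert i Pᶜ).card = m := by rw [Finset.card_insert_of_notMem hic, hPc]
      have hS : ((lift Pᶜ)ᶜ).card = m + 2 := by
        rw [Finset.card_compl, Fintype.card_fin, card_lift]; omega
      rw [S.transform_eq hD (fun U => ind (lift U)) hcard (rep_eq _ hcard) (S.row_insert hPc hic),
        bigG_of_last_mem (by simpa [castSucc_mem_lift] using hi)
          (by simpa using last_notMem_lift _), compl_compl, lift_insert, posSign_lift, hS]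
      have := S.sgn_F' _ hcard i (by simp)
      rw [Finset.erase_insert hic, posSign_insert] at this
      rw [this, pow_succ _ (m + 1)]
      congr 1
      · simp [mul_comm, mul_left_comm, mul_assoc, Int.units_mul_self]
      · simp
    · rw [transform_zero hD (by rwa [S.supp_F' _ hPc, compl_compl]), bigG_zero]
      simpa [castSucc_mem_lift] using hi

end Double

end Design.Sheet

/-! ### Parameters and conclusion. -/

/-- By symmetry of binomials this is the absorption identity `2m * C(2m - 1, m) = (m + 1) * C(2m, m
+ 1)`. -/
theorem choose_of_mul_eq {m N p k : ℕ} (hm : 0 < m) (hp : p = N * (2 * m).choose (m - 1))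
    (hk : k * (2 * m) = p * (m + 1)) : k = N * (2 * m - 1).choose (m - 1) := by
  obtain ⟨m, rfl⟩ : ∃ a, m = a + 1 := ⟨m - 1, by omega⟩
  have h1 : (2 * (m + 1)).choose m = (2 * (m + 1)).choose (m + 2) :=
    Nat.choose_symm_of_eq_add (by omega)
  have h2 : (2 * m + 1).choose m = (2 * m + 1).choose (m + 1) :=
    Nat.choose_symm_of_eq_add (by omega)
  have h3 := Nat.add_one_mul_choose_eq (2 * m + 1) (m + 1)
  simp only [Nat.add_sub_cancel] at *
  have e : 2 * (m + 1) - 1 = 2 * m + 1 := by omega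
  rw [e, h2]
  rw [hp, h1] at hk
  have h4 : 2 * (m + 1) = 2 * m + 1 + 1 := by ring
  rw [h4] at hk
  refine Nat.eq_of_mul_eq_mul_right (Nat.succ_pos (2 * m + 1)) ?_
  rw [Nat.succ_eq_add_one, hk, mul_assoc, mul_assoc, ← h3]
  ring

end COD

theorem mainTheorem3 (p n k m : ℕ) (hn : n = 2 * m)
    (O : Matrix (Fin p) (Fin n) (COD.Entry (Fin k)))
    (hCOD : COD.IsCOD O) (hfirst : COD.IsFirstType O) (hatomic : COD.IsAtomic O)
    (hrow : ∃ r : Fin p, {i : Fin n | O r i ≠ COD.Entry.zero}.ncard = m + 1) :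
    ((p = Nat.choose n (m - 1) ∧ k = Nat.choose (n - 1) (m - 1)) ∨
      (p = 2 * Nat.choose n (m - 1) ∧ k = 2 * Nat.choose (n - 1) (m - 1))) ∧
    ((p = 2 * Nat.choose n (m - 1) ∧ k = 2 * Nat.choose (n - 1) (m - 1)) →
      COD.Equivalent O (COD.subG n m)) ∧
    ((p = Nat.choose n (m - 1) ∧ k = Nat.choose (n - 1) (m - 1)) →
      Even m ∧ COD.Equivalent O (COD.subH m)) := by
  obtain ⟨r₀, hr₀⟩ := hrow
  have hm : 0 < m := by
    have := Set.ncard_le_card {i : Fin n | O r₀ i ≠ COD.Entry.zero}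
    rw [hr₀, Nat.card_eq_fintype_card, Fintype.card_fin] at this
    omega
  have hk : Nonempty (Fin k) := by
    obtain ⟨i, hi⟩ := Set.nonempty_of_ncard_ne_zero (s := {i : Fin n | O r₀ i ≠ .zero}) (by omega)
    rw [Set.mem_ofPred_eq] at hi
    match h : O r₀ i with
    | .zero => exact (hi h).elim
    | .lit _ _ v => exact ⟨v⟩
  obtain ⟨D, hD⟩ := hfirst.exists_design hCOD
  have hs₀ : (D.supp r₀).card = m + 1 := by
    rw [← hr₀, ← Set.ncard_coe_finset]
    congr 1
    ext i
    simp only [Finset.mem_coe, Set.mem_ofPred_eq, hD r₀ i]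
    split_ifs with h <;> simp [h]
  obtain ⟨S⟩ := D.exists_sheet hm hn r₀ hs₀
  have hR := S.forall_row hCOD hatomic hD hm hn
  have hV := S.forall_var hCOD hatomic hD hm hn
  have hkp : k * (2 * m) = p * (m + 1) := by
    have := D.card_mul_card (S.card_supp hCOD hatomic hD hm hn)
    simpa [← hn] using this
  have hsymm : n.choose (m + 1) = n.choose (m - 1) := Nat.choose_symm_of_eq_add (by omega)
  -- Positivity makes the two values of `p` different, so the implication for the other case is
  -- vacuous.
  have hpos : 0 < n.choose (m - 1) := Nat.choose_pos (by omega)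
  have hcompl : ∀ T : Finset (Fin n), T.card + 1 = m → Tᶜ.card = m + 1 := by
    intro T hT
    rw [Finset.card_compl, Fintype.card_fin]; omega
  have hcompl' : ∀ P : Finset (Fin n), P.card = m + 1 → Pᶜ.card + 1 = m := by
    intro P hP
    rw [Finset.card_compl, Fintype.card_fin]; omega
  by_cases hex : ∃ P₀ : Finset (Fin n), P₀.card = m + 1 ∧ S.F P₀ = S.F' P₀ᶜ
  · obtain ⟨P₀, hP₀, h₀⟩ := hex
    have hF : ∀ P : Finset (Fin n), P.card = m + 1 → S.F P = S.F' Pᶜ :=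
      fun P hP => S.F_eq_F'_compl hn hP₀ h₀ hP
    have hsurj : ∀ r, ∃ P : Finset (Fin n), P.card = m + 1 ∧ S.F P = r := by
      intro r
      rcases hR r with h | ⟨T, hT, h⟩
      · exact h
      · exact ⟨Tᶜ, hcompl T hT, by rw [hF _ (hcompl T hT), compl_compl, h]⟩
    have hp : p = n.choose (m - 1) := by
      have e : {P : Finset (Fin n) // P.card = m + 1} ≃ Fin p :=
        Equiv.ofBijective (fun P => S.F P.1)
          ⟨fun P Q h => Subtype.ext (S.F_injOn P.2 Q.2 h), fun r => by
            obtain ⟨P, hP, h⟩ := hsurj r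
            exact ⟨⟨P, hP⟩, h⟩⟩
      have := Fintype.card_congr e
      rw [Fintype.card_finset_len, Fintype.card_fin, Fintype.card_fin, hsymm] at this
      exact this.symm
    have hk' : k = (n - 1).choose (m - 1) := by
      have := COD.choose_of_mul_eq (N := 1) hm (by rw [hp, hn, one_mul]) hkp
      rwa [one_mul, ← hn] at this
    refine ⟨Or.inl ⟨hp, hk'⟩, fun h => by omega, fun _ => ⟨S.even hn hF hm, ?_⟩⟩
    obtain rfl : n = 2 * m - 1 + 1 := by omega
    exact S.equivalent_bigH hD hm hn hF hsurj hV
  · push Not at hex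
    have hp : p = 2 * n.choose (m - 1) := by
      have e : {P : Finset (Fin n) // P.card = m + 1} ⊕ {P : Finset (Fin n) // P.card = m + 1} ≃
          Fin p :=
        Equiv.ofBijective (Sum.elim (fun P => S.F P.1) (fun P => S.F' P.1ᶜ)) ⟨by
          refine Function.Injective.sumElim
            (fun P Q h => Subtype.ext (S.F_injOn P.2 Q.2 h))
            (fun P Q h => Subtype.ext (compl_injective
              (S.F'_injOn (hcompl' _ P.2) (hcompl' _ Q.2) h))) fun P Q h => ?_
          have h1 := S.supp_F P.1 P.2
          rw [h, S.supp_F' _ (hcompl' _ Q.2), compl_compl] at h1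
          exact hex P.1 P.2 (by rw [h, h1]), fun r => by
          rcases hR r with ⟨P, hP, h⟩ | ⟨T, hT, h⟩
          · exact ⟨Sum.inl ⟨P, hP⟩, h⟩
          · exact ⟨Sum.inr ⟨Tᶜ, hcompl T hT⟩, by simpa using h⟩⟩
      have := Fintype.card_congr e
      rw [Fintype.card_sum, Fintype.card_finset_len, Fintype.card_fin, Fintype.card_fin,
        hsymm] at this
      omega
    have hk' : k = 2 * (n - 1).choose (m - 1) := by
      have := COD.choose_of_mul_eq (N := 2) hm (by rw [hp, hn]) hkp
      rwa [← hn] at this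
    exact ⟨Or.inr ⟨hp, hk'⟩, fun _ => S.equivalent_subG hD hm hn hex hR hV, fun h => by omega⟩
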